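/- Let $n\ge 2$. Let $\mathbb R^{2,n}$ be $\mathbb R^{n+2}$ with the quadratic form $-u^2-v^2+x_1^2+\dots+x_n^2$, and $O_0(2,n)$ the identity component of its isometry group. Let $\widetilde{Ein}_{1,n}=\mathbb S^n\times\mathbb R$ with the conformal class of $ds^2-dt^2$, time-oriented by $\partial_t$; it covers $Ein_{1,n}$, the space of isotropic rays of $\mathbb R^{2,n+1}$, by $(x,t)\mapsto[\cos t,\sin t,x]$. An equator $\mathbb S^{n-1}\subset\mathbb S^n$ bounds two open hemispheres $\mathcal H_1,\mathcal H_2$, and $\widetilde{Ein}_{1,n-1}=\mathbb S^{n-1}\times\mathbb R\subset\widetilde{Ein}_{1,n}$. Causal curves are piecewise $C^1$; $J^\pm$ denote causal future and past. Let $\Gamma$ be a Gromov hyperbolic group and $\rho:\Gamma\to O_0(2,n)$ a $P_1$-Anosov representation: every sequence of pairwise distinct elements of $\rho(\Gamma)$ is $P_1$-divergent (the gap between the first two exponents of the Cartan projections tends to infinity), and there is a continuous, equivariant, transverse, dynamics-preserving map from $\partial\Gamma$ to the space of isotropic lines of $\mathbb R^{2,n}$. Its limit set is the set of attracting and repelling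 points of the $P_1$-divergent sequences of $\rho(\Gamma)$. Assume that the limit set is non-empty and negative, i.e. that it lifts to an acausal subset $\Lambda$ of $\widetilde{Ein}_{1,n-1}$, and that $\Lambda$ is not homeomorphic to $\mathbb S^{n-1}$. Put $\Omega=\widetilde{Ein}_{1,n}\setminus(J^+(\Lambda)\cup J^-(\Lambda))$ and $\partial E(\Lambda)=\Omega\cap\widetilde{Ein}_{1,n-1}$. For $A\subset\widetilde{Ein}_{1,n-1}$ put $E_i(A)=(\mathcal H_i\times\mathbb R)\setminus(J^+(A)\cup J^-(A))$. Let $\Lambda^+$ be the graph of $g^+(x)=\inf_{(x_0,t_0)\in\Lambda}(t_0+d(x,x_0))$ over $\mathbb S^{n-1}$, where $d$ is the spherical distance. Through the embedding $A\mapsto\mathrm{diag}(A,1)$ of $O(2,n)$ in $O(2,n+1)$, $\rho(\Gamma)$ acts on $\Omega$ by the group of those lifts to $\widetilde{Ein}_{1,n}$ of its elements that preserve $\Lambda$; quotients by $\rho(\Gamma)$ are quotients by this group. In $M=\rho(\Gamma)\backslash\Omega$ consider $M^i=\rho(\Gamma)\backslash E_i(\Lambda)$, $B^i=\rho(\Gamma)\backslash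 E_i(\Lambda^+)$ and $O=\rho(\Gamma)\backslash\partial E(\Lambda)$. Then, for $i=1,2$: $O$ is non-empty, $B^i\subset M^i$, and no future causal curve of $M$ starting from a point of $B^i$ reaches $O$. More precisely, $B^i$ is exactly the interior of the complement in $M^i$ of the past of $O$, and the set of all points of $M^i$ from which no future causal curve reaches $O$ is the union of $B^i$ and of the future horizon, the boundary of $B^i$ in $M^i$. Moreover $B^i$ is connected, and it is non-empty as soon as $\Lambda$ has at least two points; it is then the unique connected component of the interior of the complement in $M^i$ of the past of $O$, i.e. a black hole in the sense of Barbot, Bonsante and Schlenker. -/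

import Mathlib

open Set Filter Topology
open scoped LinearAlgebra.Projectivization Matrix

noncomputable section

namespace AdSBlackHole

/-! ## Hyperbolic groups and their Gromov boundary -/

section Hyperbolic

variable {Γ : Type*} [Group Γ]

/-- The Cayley graph of `Γ` with respect to the finite set `S`. -/
abbrev cayley (S : Finset Γ) : SimpleGraph Γ := SimpleGraph.mulCayley (S : Set Γ)

/-- Gromov product `(x | y)_w` for the word metric. -/
def gromovProduct (S : Finset Γ) (w x y : Γ) : ℝ :=
  (((cayley S).dist w x : ℝ) + (cayley S).dist w y - (cayley S).dist x y) / 2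

/-- `S` is a finite generating set of `Γ` for which the word metric is Gromov hyperbolic
(four point condition). -/
structure IsHyperbolicGroup (S : Finset Γ) : Prop where
  generates : Subgroup.closure (S : Set Γ) = ⊤
  hyperbolic : ∃ δ : ℝ, ∀ w x y z : Γ,
    min (gromovProduct S w x y) (gromovProduct S w y z) - δ ≤ gromovProduct S w x z

/-- Left translations are automorphisms of the Cayley graph. -/
def translate (S : Finset Γ) (g : Γ) : cayley S ≃g cayley S where
  toEquiv := Equiv.mulLeft g
  map_rel_iff' := by
    intro a b
    simp

theorem edist_le_of_hom (S : Finset Γ) (g a b : Γ) :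
    (cayley S).edist (g * a) (g * b) ≤ (cayley S).edist a b := by
  refine le_iInf fun w => ?_
  have h := SimpleGraph.edist_le (w.map (translate S g).toHom)
  rw [SimpleGraph.Walk.length_map] at h
  exact h

theorem edist_mul_left (S : Finset Γ) (g a b : Γ) :
    (cayley S).edist (g * a) (g * b) = (cayley S).edist a b := by
  refine le_antisymm (edist_le_of_hom S g a b) ?_
  have h := edist_le_of_hom S g⁻¹ (g * a) (g * b)
  simpa using h

/-- Geodesic rays in the Cayley graph, issued from any vertex. -/
def Ray (S : Finset Γ) : Type _ :=
  {r : ℕ → Γ // ∀ i k : ℕ, (cayley S).edist (r i) (r (i + k)) = k}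

/-- Two rays are asymptotic if they stay at bounded distance from one another. -/
instance rayAsymptotic (S : Finset Γ) : Setoid (Ray S) where
  r r₁ r₂ := ∃ C : ℕ, ∀ i, (cayley S).edist (r₁.1 i) (r₂.1 i) ≤ C
  iseqv :=
    { refl := fun _ => ⟨0, fun _ => by simp⟩
      symm := fun ⟨C, h⟩ => ⟨C, fun i => by rw [SimpleGraph.edist_comm]; exact h i⟩
      trans := fun ⟨C, h⟩ ⟨D, k⟩ => ⟨C + D, fun i => by
        rw [Nat.cast_add]
        exact SimpleGraph.edist_triangle.trans (add_le_add (h i) (k i))⟩ }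

/-- The Gromov boundary `∂Γ`: asymptoty classes of geodesic rays. -/
def Boundary (S : Finset Γ) : Type _ := Quotient (rayAsymptotic S)

/-- Pointwise convergence of rays (`Γ` being discrete). -/
instance (S : Finset Γ) : TopologicalSpace (Ray S) :=
  TopologicalSpace.induced Subtype.val (@Pi.topologicalSpace ℕ (fun _ => Γ) (fun _ => ⊥))

/-- The boundary carries the quotient topology. -/
instance (S : Finset Γ) : TopologicalSpace (Boundary S) :=
  TopologicalSpace.coinduced (Quotient.mk (rayAsymptotic S)) inferInstance

/-- The action of `Γ` on rays by left translation. -/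
def Ray.smul {S : Finset Γ} (g : Γ) (r : Ray S) : Ray S :=
  ⟨fun i => g * r.1 i, fun i k => by rw [edist_mul_left]; exact r.2 i k⟩

/-- The action of `Γ` on its boundary. -/
def Boundary.smul {S : Finset Γ} (g : Γ) : Boundary S → Boundary S :=
  Quotient.map (Ray.smul g) (by
    rintro a b ⟨C, h⟩
    exact ⟨C, fun i => by
      change (cayley S).edist (g * a.1 i) (g * b.1 i) ≤ C
      rw [edist_mul_left]; exact h i⟩)

/-- `η` is the attracting fixed point of `γ` in `∂Γ`: the powers `γ ^ k` converge to `η` as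
`k → +∞` in `Γ ∪ ∂Γ` (which forces `γ` to have infinite order). -/
def IsAttractingInBoundary (S : Finset Γ) (γ : Γ) (η : Boundary S) : Prop :=
  ∃ r : Ray S, Quotient.mk (rayAsymptotic S) r = η ∧
    Tendsto (fun km : ℕ × ℕ => gromovProduct S 1 (γ ^ km.1) (r.1 km.2))
      (atTop ×ˢ atTop) atTop

end Hyperbolic

/-! ## The group `O₀(2,n)` and the projective Einstein universe -/

/-- `ℝ^{2,n}`: the two coordinates `u, v` are indexed by `Fin 2`. -/
abbrev V (n : ℕ) : Type := Fin 2 ⊕ Fin n → ℝ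

/-- Square matrices acting on `ℝ^{2,n}`. -/
abbrev Mat (n : ℕ) : Type := Matrix (Fin 2 ⊕ Fin n) (Fin 2 ⊕ Fin n) ℝ

/-- The bilinear form of signature `(2,n)`. -/
def form {n : ℕ} (x y : V n) : ℝ :=
  -(∑ a : Fin 2, x (Sum.inl a) * y (Sum.inl a)) + ∑ j : Fin n, x (Sum.inr j) * y (Sum.inr j)

/-- The group `O(2,n)`, as a set of matrices. -/
def O (n : ℕ) : Set (Mat n) := {A | ∀ x y : V n, form (A *ᵥ x) (A *ᵥ y) = form x y}

/-- The identity component `O₀(2,n)` of `O(2,n)`. -/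
def O₀ (n : ℕ) : Set (Mat n) := connectedComponentIn (O n) 1

/-- The maximal compact subgroup `K = O(n+2) ∩ O₀(2,n)`. -/
def K (n : ℕ) : Set (Mat n) := {A | A ∈ O₀ n ∧ Aᵀ * A = 1}

/-- The element of the Cartan subgroup with parameters `(lam, mu)`: a boost of parameter `lam`
in the plane `(u, x₁)` and a boost of parameter `mu` in the plane `(v, x₂)`, i.e. in a suitable
basis the diagonal matrix `(e^lam, e^mu, 1, …, 1, e^{-mu}, e^{-lam})`. -/
def boost (n : ℕ) (lam mu : ℝ) : Mat n :=
  let w : ℕ → ℝ := fun m => if m = 0 then lam else if m = 1 then mu else 0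
  Matrix.of fun i j =>
    match i, j with
    | Sum.inl a, Sum.inl b => if a = b then Real.cosh (w a) else 0
    | Sum.inl a, Sum.inr j => if (a : ℕ) = (j : ℕ) then Real.sinh (w a) else 0
    | Sum.inr i, Sum.inl b => if (i : ℕ) = (b : ℕ) then Real.sinh (w b) else 0
    | Sum.inr i, Sum.inr j => if i = j then Real.cosh (w i) else 0

/-- The isotropic eigenvector of `boost n lam mu` for the eigenvalue `e^lam`. -/
def eFirst (n : ℕ) : V n := Sum.elim (fun a => if (a : ℕ) = 0 then 1 else 0)
  (fun j => if (j : ℕ) = 0 then 1 else 0)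

/-- The isotropic eigenvector of `boost n lam mu` for the eigenvalue `e^{-lam}`. -/
def eLast (n : ℕ) : V n := Sum.elim (fun a => if (a : ℕ) = 0 then 1 else 0)
  (fun j => if (j : ℕ) = 0 then -1 else 0)

/-- `g = k a l` is a Cartan decomposition, with Cartan projection `a = a(lam, mu)`. For `n ≥ 3`
one can moreover take `mu ≥ 0`; for `n = 2` the Weyl chamber of `O₀(2,2)` is `|mu| ≤ lam`, and
`|mu|` is the exponent of the second singular value in all cases. -/
def IsCartanDecomposition {n : ℕ} (g k l : Mat n) (lam mu : ℝ) : Prop :=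
  k ∈ K n ∧ l ∈ K n ∧ |mu| ≤ lam ∧ g = k * boost n lam mu * l

/-- `P₁`-divergence: the gap between the first two exponents of the Cartan projections
tends to infinity. -/
def IsP1Divergent {n : ℕ} (g : ℕ → Mat n) : Prop :=
  ∃ (k l : ℕ → Mat n) (lam mu : ℕ → ℝ),
    (∀ i, IsCartanDecomposition (g i) (k i) (l i) (lam i) (mu i)) ∧
    Tendsto (fun i => lam i - |mu i|) atTop atTop

/-- The projective space of `ℝ^{2,n}` with its quotient topology. -/
instance (n : ℕ) : TopologicalSpace (ℙ ℝ (V n)) :=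
  TopologicalSpace.coinduced (Projectivization.mk' ℝ) inferInstance

/-- The projective model of the Einstein universe of dimension `n`: isotropic lines. -/
def projEin (n : ℕ) : Set (ℙ ℝ (V n)) := {p | form p.rep p.rep = 0}

open Classical in
/-- The projective transformation defined by an (invertible) matrix. -/
def projAct {n : ℕ} (A : Mat n) (p : ℙ ℝ (V n)) : ℙ ℝ (V n) :=
  if h : Function.Injective A.mulVecLin then p.map A.mulVecLin h else p

/-- `p` and `q` are the attracting and the repelling points of a subsequence of the
`P₁`-divergent sequence `g`. -/
def IsAttractingRepelling {n : ℕ} (g : ℕ → Mat n) (p q : ℙ ℝ (V n)) : Prop :=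
  ∃ (φ : ℕ → ℕ) (k l : ℕ → Mat n) (lam mu : ℕ → ℝ) (kInf lInf : Mat n), StrictMono φ ∧
    (∀ i, IsCartanDecomposition (g (φ i)) (k i) (l i) (lam i) (mu i)) ∧
    Tendsto k atTop (𝓝 kInf) ∧ Tendsto l atTop (𝓝 lInf) ∧
    p.submodule = Submodule.span ℝ {kInf *ᵥ eFirst n} ∧
    q.submodule = Submodule.span ℝ {lInf⁻¹ *ᵥ eLast n}

/-- The limit set of a subgroup `H` of `O₀(2,n)`: the attracting and repelling points of the
`P₁`-divergent sequences of `H`. -/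
def limitSet {n : ℕ} (H : Set (Mat n)) : Set (ℙ ℝ (V n)) :=
  {p | ∃ g : ℕ → Mat n, (∀ i, g i ∈ H) ∧ IsP1Divergent g ∧
    ∃ q, IsAttractingRepelling g p q ∨ IsAttractingRepelling g q p}

/-- `p` is an attracting fixed point of `A` in the projective Einstein universe. -/
def IsAttractingInEin {n : ℕ} (A : Mat n) (p : ℙ ℝ (V n)) : Prop :=
  projAct A p = p ∧ ∃ U ∈ 𝓝[projEin n] p, ∀ W ∈ 𝓝[projEin n] p,
    ∀ᶠ k : ℕ in atTop, (projAct A)^[k] '' (U ∩ projEin n) ⊆ W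

/-- `P₁`-Anosov representations of the hyperbolic group `Γ` into `O₀(2,n)`. -/
structure IsP1Anosov {Γ : Type*} [Group Γ] (S : Finset Γ) {n : ℕ} (ρ : Γ →* Mat n) : Prop where
  mem_O₀ : ∀ γ, ρ γ ∈ O₀ n
  divergent : ∀ g : ℕ → Mat n, Function.Injective g → (∀ i, g i ∈ Set.range ρ) → IsP1Divergent g
  boundaryMap : ∃ ξ : Boundary S → ℙ ℝ (V n), Continuous ξ ∧ (∀ η, ξ η ∈ projEin n) ∧
    (∀ γ η, ξ (Boundary.smul γ η) = projAct (ρ γ) (ξ η)) ∧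
    (∀ η η', η ≠ η' → form (ξ η).rep (ξ η').rep ≠ 0) ∧
    (∀ γ η, IsAttractingInBoundary S γ η → IsAttractingInEin (ρ γ) (ξ η))

/-! ## The universal Einstein universe and its causal structure -/

/-- The round sphere of dimension `k - 1`, in `ℝ^k`. -/
abbrev Sph (k : ℕ) : Type := Metric.sphere (0 : EuclideanSpace ℝ (Fin k)) 1

/-- The universal Einstein universe of dimension `k` (space dimension `k - 1`): the product of
the round sphere and `ℝ`, with the conformal class of `ds² - dt²`, time-oriented by `∂/∂t`. -/
abbrev Ein (k : ℕ) : Type := Sph k × ℝ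

/-- A future causal curve of class `C¹` on `[a, b]` in the universal Einstein universe: its
velocity `(x', t')` is everywhere (one-sided at `a` and `b`) causal and future, that is
`|x'| ≤ t'` and `t' > 0`. -/
def IsFutureCausalArc {k : ℕ} (a b : ℝ) (c : ℝ → Ein k) : Prop :=
  a < b ∧
  ContDiffOn ℝ 1 (fun s => ((c s).1 : EuclideanSpace ℝ (Fin k))) (Icc a b) ∧
  ContDiffOn ℝ 1 (fun s => (c s).2) (Icc a b) ∧
  ∀ s ∈ Icc a b,
    ‖derivWithin (fun s => ((c s).1 : EuclideanSpace ℝ (Fin k))) (Icc a b) s‖ ≤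
      derivWithin (fun s => (c s).2) (Icc a b) s ∧
    0 < derivWithin (fun s => (c s).2) (Icc a b) s

/-- Piecewise `C¹` future causal curves, parametrized by `[0, 1]`. -/
def IsFutureCausalCurve {k : ℕ} (c : ℝ → Ein k) : Prop :=
  ∃ (N : ℕ) (t : ℕ → ℝ), t 0 = 0 ∧ t N = 1 ∧
    ∀ i < N, IsFutureCausalArc (t i) (t (i + 1)) c

/-- `q` lies in the causal future of `p`. -/
def CausalLE {k : ℕ} (p q : Ein k) : Prop :=
  p = q ∨ ∃ c : ℝ → Ein k, IsFutureCausalCurve c ∧ c 0 = p ∧ c 1 = q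

/-- The causal future of a set. -/
def JPlus {k : ℕ} (A : Set (Ein k)) : Set (Ein k) := {q | ∃ p ∈ A, CausalLE p q}

/-- The causal past of a set. -/
def JMinus {k : ℕ} (A : Set (Ein k)) : Set (Ein k) := {q | ∃ p ∈ A, CausalLE q p}

/-- A set is acausal if no causal curve joins two distinct points of it. -/
def IsAcausal {k : ℕ} (A : Set (Ein k)) : Prop := ∀ p ∈ A, ∀ q ∈ A, p ≠ q → ¬ CausalLE p q

/-- The invisible domain of `A`: the points that are not causally related to a point of `A`. -/
def invisibleDomain {k : ℕ} (A : Set (Ein k)) : Set (Ein k) := (JPlus A ∪ JMinus A)ᶜ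

/-- The isotropic vector `(cos t, sin t, x)` over the point `(x, t)`. The ray that it spans is
the image of `(x, t)` under the universal covering of the Klein model. -/
def lightVec {k : ℕ} (p : Ein k) : V k :=
  Sum.elim ![Real.cos p.2, Real.sin p.2] (fun j => (p.1 : EuclideanSpace ℝ (Fin k)) j)

theorem lightVec_ne_zero {k : ℕ} (p : Ein k) : lightVec p ≠ 0 := by
  intro h
  have h0 : Real.cos p.2 = 0 := congrFun h (Sum.inl 0)
  have h1 : Real.sin p.2 = 0 := congrFun h (Sum.inl 1)
  have h2 := Real.sin_sq_add_cos_sq p.2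
  rw [h0, h1] at h2
  norm_num at h2

/-- The covering of the projective Einstein universe by the universal one. -/
def einProj {k : ℕ} (p : Ein k) : ℙ ℝ (V k) := Projectivization.mk ℝ (lightVec p) (lightVec_ne_zero p)

/-! ## Regular domains -/

/-- The equator of the sphere, where the last coordinate vanishes. -/
def equator {k : ℕ} (x : Sph k) : Sph (k + 1) :=
  ⟨WithLp.toLp 2 (Fin.snoc (α := fun _ => ℝ) (fun j => (x : EuclideanSpace ℝ (Fin k)) j) 0), by
    have hx : ‖(x : EuclideanSpace ℝ (Fin k))‖ = 1 := by simp
    rw [EuclideanSpace.norm_eq] at hx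
    rw [mem_sphere_zero_iff_norm, EuclideanSpace.norm_eq, Fin.sum_univ_castSucc]
    simpa using hx⟩

/-- The inclusion of the universal Einstein universe of dimension `k` in that of dimension
`k + 1`. -/
def einIncl {k : ℕ} (p : Ein k) : Ein (k + 1) := (equator p.1, p.2)

/-- The last coordinate of the sphere component. -/
def height {k : ℕ} (p : Ein (k + 1)) : ℝ := (p.1 : EuclideanSpace ℝ (Fin (k + 1))) (Fin.last k)

/-- The two copies of (the universal cover of) anti-de Sitter space in the universal Einstein
universe: the products of the two open hemispheres with `ℝ`. -/
def adsCopy (k : ℕ) (i : Fin 2) : Set (Ein (k + 1)) := {p | 0 < (-1 : ℝ) ^ (i : ℕ) * height p}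

/-- The AdS-regular domain `E_i(A)` of a subset `A` of the conformal boundary. -/
def regularDomain {k : ℕ} (i : Fin 2) (A : Set (Ein k)) : Set (Ein (k + 1)) :=
  adsCopy k i ∩ invisibleDomain (einIncl '' A)

/-- The function `x ↦ inf { t₀ + d(x, x₀) : (x₀, t₀) ∈ A }`, `d` the distance of the sphere. -/
def upperFun {k : ℕ} (A : Set (Ein k)) (x : Sph k) : ℝ :=
  ⨅ q : A, (q.1.2 + InnerProductGeometry.angle (x : EuclideanSpace ℝ (Fin k)) q.1.1)

/-- The graph `A⁺` of the previous function. -/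
def upperGraph {k : ℕ} (A : Set (Ein k)) : Set (Ein k) := {p | p.2 = upperFun A p.1}

/-! ## The quotient spacetime -/

/-- The embedding `A ↦ diag(A, 1)` of `O(2,n)` in `O(2,n+1)`. -/
def stab {n : ℕ} (A : Mat n) : Mat (n + 1) :=
  let e : (Fin 2 ⊕ Fin n) ⊕ Fin 1 ≃ Fin 2 ⊕ Fin (n + 1) :=
    (Equiv.sumAssoc (Fin 2) (Fin n) (Fin 1)).trans (Equiv.sumCongr (Equiv.refl _) finSumFinEquiv)
  Matrix.reindexRingEquiv ℝ e (Matrix.fromBlocks A 0 0 1)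

theorem stab_one {n : ℕ} : stab (1 : Mat n) = 1 := by
  unfold stab
  rw [Matrix.fromBlocks_one, map_one]

theorem stab_mul {n : ℕ} (A B : Mat n) : stab (A * B) = stab A * stab B := by
  unfold stab
  rw [← map_mul, Matrix.fromBlocks_multiply]
  simp

section Quotient

variable {Γ : Type*} [Group Γ] {n : ℕ}

/-- The group of the homeomorphisms of the universal Einstein universe that lift the action of
an element of `ρ(Γ)` and preserve the set `A` of the boundary. -/
def liftGroup (ρ : Γ →* Mat n) (A : Set (Ein n)) : Subgroup (Ein (n + 1) ≃ₜ Ein (n + 1)) where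
  carrier := {f | (∃ γ : Γ, ∀ p, ∃ r : ℝ, 0 < r ∧
      lightVec (f p) = r • (stab (ρ γ) *ᵥ lightVec p)) ∧
    f '' (einIncl '' A) = einIncl '' A}
  one_mem' := ⟨⟨1, fun p => ⟨1, one_pos, by simp [stab_one]⟩⟩, by
    change (id : Ein (n + 1) → Ein (n + 1)) '' _ = _
    exact image_id _⟩
  mul_mem' := by
    rintro f g ⟨⟨γ, hγ⟩, hf⟩ ⟨⟨γ', hγ'⟩, hg⟩
    refine ⟨⟨γ * γ', fun p => ?_⟩, ?_⟩
    · obtain ⟨r, hr, h⟩ := hγ (g p)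
      obtain ⟨r', hr', h'⟩ := hγ' p
      refine ⟨r * r', mul_pos hr hr', ?_⟩
      rw [Homeomorph.mul_apply, h, h', map_mul, stab_mul, Matrix.mulVec_smul,
        Matrix.mulVec_mulVec, smul_smul]
    · change (f ∘ g) '' _ = _
      rw [image_comp, hg, hf]
  inv_mem' := by
    rintro f ⟨⟨γ, hγ⟩, hf⟩
    refine ⟨⟨γ⁻¹, fun p => ?_⟩, ?_⟩
    · obtain ⟨r, hr, h⟩ := hγ (f.symm p)
      refine ⟨r⁻¹, inv_pos.2 hr, ?_⟩
      rw [Homeomorph.apply_symm_apply] at h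
      rw [h, Matrix.mulVec_smul, Matrix.mulVec_mulVec, ← stab_mul, ← map_mul, smul_smul,
        inv_mul_cancel₀ hr.ne', one_smul, inv_mul_cancel, map_one, stab_one, Matrix.one_mulVec]
      rfl
    · change f.symm '' _ = _
      conv_lhs => rw [← hf]
      rw [← image_comp]
      simp

/-- The orbit relation of this group on the invisible domain of `A`. -/
def orbitSetoid (ρ : Γ →* Mat n) (A : Set (Ein n)) :
    Setoid (invisibleDomain (einIncl '' A)) where
  r p q := ∃ f ∈ liftGroup ρ A, f p.1 = q.1
  iseqv :=
    { refl := fun p => ⟨1, one_mem _, rfl⟩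
      symm := fun {p q} ⟨f, hf, h⟩ => ⟨f⁻¹, inv_mem hf, by
        rw [← h]; exact f.symm_apply_apply p.1⟩
      trans := fun ⟨f, hf, h⟩ ⟨g, hg, h'⟩ => ⟨g * f, mul_mem hg hf, by
        rw [Homeomorph.mul_apply, h, h']⟩ }

/-- The quotient `M_ρ(Γ)` of the invisible domain, with the quotient topology. -/
def M (ρ : Γ →* Mat n) (A : Set (Ein n)) : Type := Quotient (orbitSetoid ρ A)

instance (ρ : Γ →* Mat n) (A : Set (Ein n)) : TopologicalSpace (M ρ A) :=
  TopologicalSpace.coinduced (Quotient.mk (orbitSetoid ρ A)) inferInstance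

/-- The image in `M_ρ(Γ)` of a subset of the invisible domain. -/
def quotImage (ρ : Γ →* Mat n) (A : Set (Ein n)) (X : Set (Ein (n + 1))) : Set (M ρ A) :=
  Quotient.mk (orbitSetoid ρ A) '' {p | p.1 ∈ X}

/-- `M^i_ρ(Γ)`, the quotient of the regular domain `E_i(A)`. -/
def Mi (ρ : Γ →* Mat n) (A : Set (Ein n)) (i : Fin 2) : Set (M ρ A) :=
  quotImage ρ A (regularDomain i A)

/-- `B^i_ρ(Γ)`, the quotient of the regular domain `E_i(A⁺)`. -/
def Bi (ρ : Γ →* Mat n) (A : Set (Ein n)) (i : Fin 2) : Set (M ρ A) :=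
  quotImage ρ A (regularDomain i (upperGraph A))

/-- `O_ρ(Γ)`, the quotient of the part of the invisible domain in the conformal boundary. -/
def conformalBoundary (ρ : Γ →* Mat n) (A : Set (Ein n)) : Set (M ρ A) :=
  quotImage ρ A (Set.range einIncl)

/-- Piecewise `C¹` future causal curves of `M_ρ(Γ)`, parametrized by `[0, 1]`: each piece is the
projection of a future causal curve of class `C¹` contained in the invisible domain. -/
def IsFutureCausalCurveInM (ρ : Γ →* Mat n) (A : Set (Ein n)) (c : ℝ → M ρ A) : Prop :=
  ∃ (N : ℕ) (t : ℕ → ℝ), t 0 = 0 ∧ t N = 1 ∧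
    ∀ i < N, ∃ d : ℝ → Ein (n + 1), IsFutureCausalArc (t i) (t (i + 1)) d ∧
      ∀ s ∈ Icc (t i) (t (i + 1)), ∃ h : d s ∈ invisibleDomain (einIncl '' A),
        c s = Quotient.mk (orbitSetoid ρ A) ⟨d s, h⟩

/-- Some future causal curve of `M_ρ(Γ)` starting from `P` ends in `O_ρ(Γ)`. -/
def SeesBoundary (ρ : Γ →* Mat n) (A : Set (Ein n)) (P : M ρ A) : Prop :=
  ∃ c : ℝ → M ρ A, IsFutureCausalCurveInM ρ A c ∧ c 0 = P ∧ c 1 ∈ conformalBoundary ρ A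

/-- The past of `O_ρ(Γ)` in `M^i_ρ(Γ)`. -/
def pastOfBoundary (ρ : Γ →* Mat n) (A : Set (Ein n)) (i : Fin 2) : Set (M ρ A) :=
  {P | P ∈ Mi ρ A i ∧ SeesBoundary ρ A P}

end Quotient

end AdSBlackHole

end

noncomputable section

namespace AdSBlackHole

/-! In `Sph k × ℝ` a point `p` precedes `q` exactly when the spherical distance of their positions
is at most the difference of their times (`causalLE_iff`). For a compact acausal `A` the invisible
domain is therefore the open region between the graphs of two 1-Lipschitz functions, `lowerFun` and
`upperFun` (`mem_invisibleDomain_iff_lt`), and all the geometry becomes comparison of such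
functions.

Over the equator the top edge of the invisible domain is `Λ⁺`. A point of `E_i(Λ)` sees the
conformal boundary if and only if its light cone passes strictly below `Λ⁺` at some point, that is,
if and only if it lies strictly below the graph of the lower function of `Λ⁺`
(`mem_unseeingSet_iff`). Taking the infimum against the distance twice changes nothing, so `Λ` and
`Λ⁺` have the same upper function; hence `E_i(Λ⁺)` is the part of `E_i(Λ)` strictly above that
graph, the graph itself being the horizon. As the region between two graphs over a hemisphere,
`E_i(Λ⁺)` is connected. The boundary part is non-empty because an acausal `Λ` lying over the whole
equator would be a graph, hence a sphere.

These statements descend to the quotient because the lifts of `ρ(Γ)` preserve causality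
(`IsLift.causalLE`: a determinant that never vanishes on `O(2,n)` along null pairs keeps its sign on
the identity component) and because the quotient map is open. Compactness of `Λ` comes from
closedness of the limit set, by a diagonal extraction, together with acausality. -/

open InnerProductGeometry in
/-- The distance of the round sphere. -/
def sdist {k : ℕ} (x y : Sph k) : ℝ :=
  angle (x : EuclideanSpace ℝ (Fin k)) (y : EuclideanSpace ℝ (Fin k))

/-! ### Spherical distance and great circles. -/

section SphereDistance

variable {k : ℕ}

theorem norm_sph (x : Sph k) : ‖(x : EuclideanSpace ℝ (Fin k))‖ = 1 := by simp

theorem sph_ne_zero (x : Sph k) : (x : EuclideanSpace ℝ (Fin k)) ≠ 0 := by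
  intro h
  have := norm_sph x
  rw [h, norm_zero] at this
  exact zero_ne_one this

theorem sdist_nonneg (x y : Sph k) : 0 ≤ sdist x y := InnerProductGeometry.angle_nonneg _ _

theorem sdist_le_pi (x y : Sph k) : sdist x y ≤ Real.pi := InnerProductGeometry.angle_le_pi _ _

theorem sdist_comm (x y : Sph k) : sdist x y = sdist y x := InnerProductGeometry.angle_comm _ _

theorem sdist_triangle (x y z : Sph k) : sdist x z ≤ sdist x y + sdist y z :=
  InnerProductGeometry.angle_le_angle_add_angle _ _ _

theorem sdist_self (x : Sph k) : sdist x x = 0 :=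
  InnerProductGeometry.angle_self (sph_ne_zero x)

theorem eq_of_sdist_eq_zero {x y : Sph k} (h : sdist x y = 0) : x = y :=
  Subtype.ext (InnerProductGeometry.eq_of_angle_eq_zero_of_norm_eq h
    (by rw [norm_sph, norm_sph]))

theorem sdist_neg_right (x y : Sph k) : sdist x (-y) = Real.pi - sdist x y :=
  InnerProductGeometry.angle_neg_right _ _

theorem sdist_neg_left (x y : Sph k) : sdist (-x) y = Real.pi - sdist x y :=
  InnerProductGeometry.angle_neg_left _ _

theorem cos_sdist (x y : Sph k) :
    Real.cos (sdist x y) = inner ℝ (x : EuclideanSpace ℝ (Fin k)) (y : EuclideanSpace ℝ (Fin k)) :=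
  (InnerProductGeometry.inner_eq_cos_angle_of_norm_eq_one (norm_sph x) (norm_sph y)).symm

theorem sdist_eq_arccos (x y : Sph k) : sdist x y =
    Real.arccos (inner ℝ (x : EuclideanSpace ℝ (Fin k)) (y : EuclideanSpace ℝ (Fin k))) := by
  rw [← cos_sdist, Real.arccos_cos (sdist_nonneg x y) (sdist_le_pi x y)]

theorem continuous_sdist_left (y : Sph k) : Continuous fun x => sdist x y := by
  simp only [sdist_eq_arccos]
  exact Real.continuous_arccos.comp (continuous_subtype_val.inner continuous_const)

/-- The great circle through `x` in the direction `e`. -/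
def greatCircle (x : Sph k) {e : EuclideanSpace ℝ (Fin k)} (he : ‖e‖ = 1)
    (hxe : inner ℝ (x : EuclideanSpace ℝ (Fin k)) e = 0) (a : ℝ) : Sph k :=
  ⟨Real.cos a • (x : EuclideanSpace ℝ (Fin k)) + Real.sin a • e, by
    rw [mem_sphere_zero_iff_norm, ← sq_eq_sq₀ (norm_nonneg _) zero_le_one, norm_add_sq_real,
      real_inner_smul_left, real_inner_smul_right, hxe, norm_smul, norm_smul, norm_sph, he,
      Real.norm_eq_abs, Real.norm_eq_abs, mul_one, mul_one, sq_abs, sq_abs]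
    linarith [Real.sin_sq_add_cos_sq a]⟩

variable (x : Sph k) {e : EuclideanSpace ℝ (Fin k)} (he : ‖e‖ = 1)
    (hxe : inner ℝ (x : EuclideanSpace ℝ (Fin k)) e = 0)

theorem greatCircle_zero : greatCircle x he hxe 0 = x :=
  Subtype.ext (by simp [greatCircle])

theorem continuous_greatCircle : Continuous (greatCircle x he hxe) := by
  refine Continuous.subtype_mk (f := fun a => Real.cos a • (x : EuclideanSpace ℝ (Fin k)) + Real.sin a • e) (by fun_prop) _

theorem cos_sdist_greatCircle (a b : ℝ) :
    Real.cos (sdist (greatCircle x he hxe a) (greatCircle x he hxe b)) = Real.cos (a - b) := by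
  rw [cos_sdist]
  simp only [greatCircle, inner_add_left, inner_add_right, real_inner_smul_left,
    real_inner_smul_right, real_inner_comm (x : EuclideanSpace ℝ (Fin k)) e, hxe,
    real_inner_self_eq_norm_sq, he, norm_sph]
  rw [Real.cos_sub]
  ring

theorem sdist_greatCircle {a b : ℝ} (hab : |a - b| ≤ Real.pi) :
    sdist (greatCircle x he hxe a) (greatCircle x he hxe b) = |a - b| := by
  have h := cos_sdist_greatCircle x he hxe a b
  rw [← Real.cos_abs (a - b)] at h
  exact Real.injOn_cos ⟨sdist_nonneg _ _, sdist_le_pi _ _⟩ ⟨abs_nonneg _, hab⟩ h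

theorem exists_orthogonal_unit (hk : 2 ≤ k) (x : Sph k) : ∃ e : EuclideanSpace ℝ (Fin k),
    ‖e‖ = 1 ∧ inner ℝ (x : EuclideanSpace ℝ (Fin k)) e = 0 := by
  have hF : Fact (Module.finrank ℝ (EuclideanSpace ℝ (Fin k)) = (k - 1) + 1) :=
    ⟨by rw [finrank_euclideanSpace_fin]; omega⟩
  have h := Submodule.finrank_orthogonal_span_singleton (𝕜 := ℝ) (n := k - 1) (sph_ne_zero x)
  have : Nontrivial (Submodule.span ℝ {(x : EuclideanSpace ℝ (Fin k))})ᗮ :=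
    Module.nontrivial_of_finrank_pos (R := ℝ) (by omega)
  obtain ⟨v, hv⟩ := exists_ne (0 : (Submodule.span ℝ {(x : EuclideanSpace ℝ (Fin k))})ᗮ)
  have hv' : (v : EuclideanSpace ℝ (Fin k)) ≠ 0 := fun h => hv (Subtype.ext h)
  refine ⟨‖(v : EuclideanSpace ℝ (Fin k))‖⁻¹ • v, ?_, ?_⟩
  · rw [norm_smul, norm_inv, norm_norm, inv_mul_cancel₀ (norm_ne_zero_iff.2 hv')]
  · rw [real_inner_smul_right, Submodule.mem_orthogonal_singleton_iff_inner_right.1 v.2, mul_zero]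

/-- If `x` and `y` are equal or antipodal, any orthogonal direction works, and one exists since `2 ≤
k`. Otherwise the direction is the normalized component of `y` orthogonal to `x`, whose length is
the sine of the distance. -/
theorem exists_greatCircle (hk : 2 ≤ k) (x y : Sph k) : ∃ (e : EuclideanSpace ℝ (Fin k))
    (he : ‖e‖ = 1) (hxe : inner ℝ (x : EuclideanSpace ℝ (Fin k)) e = 0),
    greatCircle x he hxe (sdist x y) = y := by
  obtain ⟨e₀, he₀, hxe₀⟩ := exists_orthogonal_unit hk x
  by_cases h0 : sdist x y = 0
  · refine ⟨e₀, he₀, hxe₀, ?_⟩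
    rw [h0, greatCircle_zero]
    exact eq_of_sdist_eq_zero h0
  by_cases hp : sdist x y = Real.pi
  · refine ⟨e₀, he₀, hxe₀, ?_⟩
    have : x = -y := eq_of_sdist_eq_zero (by rw [sdist_neg_right, hp, sub_self])
    rw [hp]
    apply Subtype.ext
    simp [greatCircle, this]
  have hs : 0 < Real.sin (sdist x y) :=
    Real.sin_pos_of_pos_of_lt_pi (lt_of_le_of_ne (sdist_nonneg _ _) (Ne.symm h0))
      (lt_of_le_of_ne (sdist_le_pi _ _) hp)
  have hc := cos_sdist x y
  have hsc := Real.sin_sq_add_cos_sq (sdist x y)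
  refine ⟨(Real.sin (sdist x y))⁻¹ • ((y : EuclideanSpace ℝ (Fin k)) -
    Real.cos (sdist x y) • (x : EuclideanSpace ℝ (Fin k))), ?_, ?_, ?_⟩
  · rw [← sq_eq_sq₀ (norm_nonneg _) zero_le_one, norm_smul, mul_pow, norm_sub_sq_real,
      real_inner_smul_right, real_inner_comm, ← hc, norm_smul, norm_sph, norm_sph,
      Real.norm_eq_abs, Real.norm_eq_abs, sq_abs, mul_one, sq_abs]
    field_simp
    linarith
  · rw [real_inner_smul_right, inner_sub_right, real_inner_smul_right, ← hc,
      real_inner_self_eq_norm_sq, norm_sph]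
    ring
  · apply Subtype.ext
    simp only [greatCircle]
    rw [smul_smul, mul_inv_cancel₀ hs.ne', one_smul]
    abel

/-- The chord of a spherical arc. -/
theorem norm_sub_sph (x y : Sph k) :
    ‖(x : EuclideanSpace ℝ (Fin k)) - y‖ = 2 * Real.sin (sdist x y / 2) := by
  have hs : 0 ≤ Real.sin (sdist x y / 2) :=
    Real.sin_nonneg_of_nonneg_of_le_pi (by linarith [sdist_nonneg x y])
      (by linarith [sdist_le_pi x y, Real.pi_pos])
  rw [← sq_eq_sq₀ (norm_nonneg _) (by positivity), norm_sub_sq_real, norm_sph, norm_sph,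
    ← cos_sdist]
  have h := Real.cos_two_mul (sdist x y / 2)
  have h' := Real.sin_sq_add_cos_sq (sdist x y / 2)
  rw [mul_div_cancel₀ _ (two_ne_zero)] at h
  nlinarith

end SphereDistance

/-! ### The causal relation in terms of the spherical distance. -/

section Causal

variable {k : ℕ}

theorem ein_eq_of_sdist_le {p q : Ein k} (h : sdist p.1 q.1 ≤ q.2 - p.2) (h' : q.2 ≤ p.2) :
    p = q := by
  have h0 := sdist_nonneg p.1 q.1
  exact Prod.ext (eq_of_sdist_eq_zero (by linarith)) (by linarith)

/-- The curve follows a minimizing great circle at constant speed while time grows linearly. The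
last clause, that each intermediate point is causally between the ends, later keeps such a curve
inside an invisible domain. -/
theorem exists_causalArc (hk : 2 ≤ k) {p q : Ein k} (hpq : p ≠ q)
    (h : sdist p.1 q.1 ≤ q.2 - p.2) :
    ∃ c : ℝ → Ein k, IsFutureCausalArc 0 1 c ∧ c 0 = p ∧ c 1 = q ∧ ∀ s ∈ Icc (0 : ℝ) 1,
      sdist p.1 (c s).1 ≤ (c s).2 - p.2 ∧ sdist (c s).1 q.1 ≤ q.2 - (c s).2 := by
  have hpos : 0 < q.2 - p.2 := by
    by_contra hn
    exact hpq (ein_eq_of_sdist_le h (by linarith))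
  obtain ⟨e, he, hxe, hy⟩ := exists_greatCircle hk p.1 q.1
  set θ := sdist p.1 q.1 with hθ
  have hθ0 : 0 ≤ θ := sdist_nonneg _ _
  refine ⟨fun s => (greatCircle p.1 he hxe (s * θ), p.2 + s * (q.2 - p.2)),
    ⟨zero_lt_one, ?_, ?_, ?_⟩, ?_, ?_, ?_⟩
  · simp only [greatCircle]
    fun_prop
  · fun_prop
  · intro s hs
    have hu := uniqueDiffOn_Icc (zero_lt_one (α := ℝ)) s hs
    have h1 : HasDerivAt (fun s : ℝ => p.2 + s * (q.2 - p.2)) (q.2 - p.2) s := by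
      simpa using ((hasDerivAt_id s).mul_const (q.2 - p.2)).const_add p.2
    have h2 : HasDerivAt (fun s : ℝ => Real.cos (s * θ) • (p.1 : EuclideanSpace ℝ (Fin k)) +
        Real.sin (s * θ) • e) ((-Real.sin (s * θ) * θ) • (p.1 : EuclideanSpace ℝ (Fin k)) +
        (Real.cos (s * θ) * θ) • e) s := by
      have h3 : HasDerivAt (fun s : ℝ => s * θ) θ s := by
        simpa using (hasDerivAt_id s).mul_const θ
      exact (h3.cos.smul_const _).add (h3.sin.smul_const _)
    simp only [greatCircle]
    rw [h1.hasDerivWithinAt.derivWithin hu, h2.hasDerivWithinAt.derivWithin hu]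
    refine ⟨le_trans (le_of_eq ?_) h, hpos⟩
    rw [← sq_eq_sq₀ (norm_nonneg _) hθ0, norm_add_sq_real,
      real_inner_smul_left, real_inner_smul_right, hxe, norm_smul, norm_smul, norm_sph, he,
      Real.norm_eq_abs, Real.norm_eq_abs, mul_one, mul_one, sq_abs, sq_abs]
    linear_combination θ ^ 2 * Real.sin_sq_add_cos_sq (s * θ)
  · simp [greatCircle_zero]
  · simp [hy]
  · intro s hs
    have hθp : θ ≤ Real.pi := sdist_le_pi _ _
    have hs1 : 0 ≤ s * θ := mul_nonneg hs.1 hθ0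
    have hs2 : 0 ≤ (1 - s) * θ := mul_nonneg (by linarith [hs.2]) hθ0
    have e1 : sdist p.1 (greatCircle p.1 he hxe (s * θ)) = s * θ := by
      have h0 := sdist_greatCircle p.1 he hxe (a := 0) (b := s * θ)
        (by rw [zero_sub, abs_neg, abs_of_nonneg hs1]; linarith)
      rwa [greatCircle_zero, zero_sub, abs_neg, abs_of_nonneg hs1] at h0
    have e2 : sdist (greatCircle p.1 he hxe (s * θ)) q.1 = (1 - s) * θ := by
      have h0 := sdist_greatCircle p.1 he hxe (a := s * θ) (b := θ)
        (by rw [abs_sub_comm, abs_of_nonneg (by linarith)]; linarith)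
      rw [hy, abs_sub_comm, abs_of_nonneg (by linarith)] at h0
      linarith
    refine ⟨?_, ?_⟩
    · change sdist p.1 (greatCircle p.1 he hxe (s * θ)) ≤ p.2 + s * (q.2 - p.2) - p.2
      rw [e1]
      nlinarith [hs.1]
    · change sdist (greatCircle p.1 he hxe (s * θ)) q.1 ≤ q.2 - (p.2 + s * (q.2 - p.2))
      rw [e2]
      nlinarith [hs.2]

/-- Compares a short arc with its chord, through the cubic lower bound for the sine. -/
theorem eventually_le_mul_sin {C : ℝ} (hC : 1 < C) :
    ∀ᶠ x : ℝ in 𝓝 0, 0 ≤ x → x ≤ C * Real.sin x := by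
  have hlim : Tendsto (fun x : ℝ => C * (1 - x ^ 2 / 6)) (𝓝 0) (𝓝 C) := by
    have : Continuous fun x : ℝ => C * (1 - x ^ 2 / 6) := by fun_prop
    simpa using this.tendsto 0
  filter_upwards [hlim.eventually (lt_mem_nhds hC)] with x hx h0
  have := Real.sin_ge_sub_cube h0
  nlinarith

/-- A differential comparison: the distance to the starting point need not be differentiable, but
its right slopes are asymptotically at most the speed of the curve, which causality bounds by the
derivative of time. -/
theorem sdist_le_of_causalArc {a b : ℝ} {c : ℝ → Ein k} (hc : IsFutureCausalArc a b c) :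
    sdist (c a).1 (c b).1 ≤ (c b).2 - (c a).2 := by
  obtain ⟨hab, hX, hT, hbound⟩ := hc
  have hXc := hX.continuousOn
  have hcont : ContinuousOn (fun s => (c s).1) (Icc a b) :=
    continuousOn_iff_continuous_domRestrict.2
      (Continuous.subtype_mk (continuousOn_iff_continuous_domRestrict.1 hXc) _)
  refine image_le_of_liminf_slope_right_le_deriv_boundary
    (f := fun s => sdist (c a).1 (c s).1) (B := fun s => (c s).2 - (c a).2)
    (B' := fun s => derivWithin (fun s => (c s).2) (Icc a b) s) ?_ ?_ ?_ ?_ ?_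
    (right_mem_Icc.2 hab.le)
  · simp only [sdist_comm (c a).1]
    exact (continuous_sdist_left (c a).1).comp_continuousOn hcont
  · simp [sdist_self]
  · exact hT.continuousOn.sub continuousOn_const
  · intro s hs
    have h := ((hT.differentiableOn one_ne_zero s ⟨hs.1, hs.2.le⟩).hasDerivWithinAt).sub_const
      (c a).2
    exact h.mono_of_mem_nhdsWithin (mem_of_superset (Icc_mem_nhdsGE hs.2) (Icc_subset_Icc_left hs.1))
  · intro s hs r hr
    have hsI : s ∈ Icc a b := ⟨hs.1, hs.2.le⟩
    have hd := (hX.differentiableOn one_ne_zero s hsI).hasDerivWithinAt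
    -- The speed bounds the slope of the chord, not of the arc; the room between `r'` and `r`
    -- absorbs the factor `r / r' > 1` lost in passing from one to the other.
    obtain ⟨r', hr1, hr2⟩ := exists_between (lt_of_le_of_lt (hbound s hsI).1 hr)
    have hr0 : 0 < r' := lt_of_le_of_lt (norm_nonneg _) hr1
    have hC : 1 < r / r' := (one_lt_div hr0).2 hr2
    have hle : 𝓝[>] s ≤ 𝓝[Icc a b] s :=
      le_trans (nhdsWithin_mono s Ioi_subset_Ici_self) (nhdsWithin_le_iff.2
        (mem_of_superset (Icc_mem_nhdsGE hs.2) (Icc_subset_Icc_left hs.1)))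
    have e1 := hle (hd.limsup_norm_slope_le hr1)
    have e2 : Tendsto (fun z => sdist (c s).1 (c z).1 / 2) (𝓝[>] s) (𝓝 0) := by
      have h : ContinuousOn (fun z => sdist (c s).1 (c z).1 / 2) (Icc a b) := by
        simp only [sdist_comm (c s).1]
        exact ((continuous_sdist_left (c s).1).comp_continuousOn hcont).div_const 2
      have h' := (h s hsI).mono_left hle
      simpa [ContinuousWithinAt, sdist_self] using h'
    refine Eventually.frequently ?_
    filter_upwards [e1, e2.eventually (eventually_le_mul_sin hC), self_mem_nhdsWithin]
      with z hz1 hz2 hz3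
    have hz3' : 0 < z - s := sub_pos.2 hz3
    rw [Real.norm_of_nonneg hz3'.le, norm_sub_rev, norm_sub_sph] at hz1
    have hz4 := hz2 (by linarith [sdist_nonneg (c s).1 (c z).1])
    have htri := sdist_triangle (c a).1 (c s).1 (c z).1
    rw [slope_def_field, div_lt_iff₀ hz3']
    rw [inv_mul_lt_iff₀ hz3'] at hz1
    calc sdist (c a).1 (c z).1 - sdist (c a).1 (c s).1 ≤ sdist (c s).1 (c z).1 := by linarith
      _ ≤ r / r' * (2 * Real.sin (sdist (c s).1 (c z).1 / 2)) := by linarith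
      _ < r / r' * ((z - s) * r') := by gcongr
      _ = r * (z - s) := by field_simp

theorem sdist_le_trans {p q r : Ein k} (h : sdist p.1 q.1 ≤ q.2 - p.2)
    (h' : sdist q.1 r.1 ≤ r.2 - q.2) : sdist p.1 r.1 ≤ r.2 - p.2 := by
  linarith [sdist_triangle p.1 q.1 r.1]

/-- The causal relation of the universal Einstein universe in terms of the spherical distance. -/
theorem causalLE_iff (hk : 2 ≤ k) {p q : Ein k} :
    CausalLE p q ↔ sdist p.1 q.1 ≤ q.2 - p.2 := by
  constructor
  · rintro (rfl | ⟨c, ⟨N, t, h0, hN, hc⟩, rfl, rfl⟩)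
    · simp [sdist_self]
    · have key : ∀ i ≤ N, sdist (c (t 0)).1 (c (t i)).1 ≤ (c (t i)).2 - (c (t 0)).2 := by
        intro i
        induction i with
        | zero => intro _; simp [sdist_self]
        | succ i ih =>
          intro hi
          exact sdist_le_trans (ih (by omega)) (sdist_le_of_causalArc (hc i (by omega)))
      have := key N le_rfl
      rwa [h0, hN] at this
  · intro h
    by_cases hpq : p = q
    · exact Or.inl hpq
    · obtain ⟨c, hc, hc0, hc1, -⟩ := exists_causalArc hk hpq h
      refine Or.inr ⟨c, ⟨1, fun i => i, by simp, by simp, ?_⟩, hc0, hc1⟩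
      intro i hi
      obtain rfl : i = 0 := by omega
      simpa using hc

theorem CausalLE.trans (hk : 2 ≤ k) {p q r : Ein k} (h : CausalLE p q) (h' : CausalLE q r) :
    CausalLE p r := by
  rw [causalLE_iff hk] at *
  exact sdist_le_trans h h'

theorem mem_invisibleDomain_iff (hk : 2 ≤ k) {A : Set (Ein k)} {p : Ein k} :
    p ∈ invisibleDomain A ↔ ∀ q ∈ A, |p.2 - q.2| < sdist p.1 q.1 := by
  have : p ∈ invisibleDomain A ↔ ∀ q ∈ A, ¬ CausalLE q p ∧ ¬ CausalLE p q := by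
    simp only [invisibleDomain, JPlus, JMinus, mem_compl_iff, mem_union, mem_ofPred_eq, not_or,
      not_exists, not_and]
    exact ⟨fun h q hq => ⟨h.1 q hq, h.2 q hq⟩, fun h => ⟨fun q hq => (h q hq).1, fun q hq => (h q hq).2⟩⟩
  rw [this]
  refine forall₂_congr fun q _ => ?_
  rw [causalLE_iff hk, causalLE_iff hk, sdist_comm q.1, not_le, not_le, abs_lt]
  constructor <;> rintro ⟨h1, h2⟩ <;> constructor <;> linarith

theorem isAcausal_iff (hk : 2 ≤ k) {A : Set (Ein k)} :
    IsAcausal A ↔ ∀ p ∈ A, ∀ q ∈ A, p ≠ q → |p.2 - q.2| < sdist p.1 q.1 := by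
  constructor
  · intro h p hp q hq hpq
    have h1 := h p hp q hq hpq
    have h2 := h q hq p hp hpq.symm
    rw [causalLE_iff hk] at h1 h2
    rw [sdist_comm] at h2
    rw [abs_lt]
    constructor <;> linarith
  · intro h p hp q hq hpq hc
    rw [causalLE_iff hk] at hc
    have := (abs_lt.1 (h p hp q hq hpq)).1
    linarith

theorem invisibleDomain_anti {A B : Set (Ein k)} (h : A ⊆ B) :
    invisibleDomain B ⊆ invisibleDomain A := by
  rintro p hp (⟨q, hq, hqp⟩ | ⟨q, hq, hqp⟩)
  · exact hp (Or.inl ⟨q, h hq, hqp⟩)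
  · exact hp (Or.inr ⟨q, h hq, hqp⟩)

/-- A causal curve with both ends in an invisible domain stays in it. -/
theorem mem_invisibleDomain_of_between (hk : 2 ≤ k) {A : Set (Ein k)} {p q r : Ein k}
    (hp : p ∈ invisibleDomain A) (hr : r ∈ invisibleDomain A) (hpq : CausalLE p q)
    (hqr : CausalLE q r) : q ∈ invisibleDomain A := by
  rintro (⟨a, ha, h⟩ | ⟨a, ha, h⟩)
  · exact hr (Or.inl ⟨a, ha, h.trans hk hqr⟩)
  · exact hp (Or.inr ⟨a, ha, hpq.trans hk h⟩)

end Causal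

/-! ### Extremal functions; the invisible domain as a region between two graphs. -/

section Extremal

variable {k : ℕ} {A : Set (Ein k)}

/-- The function `x ↦ sup { t₀ - d(x, x₀) : (x₀, t₀) ∈ A }`. -/
def lowerFun (A : Set (Ein k)) (x : Sph k) : ℝ :=
  -upperFun ((fun p : Ein k => (p.1, -p.2)) '' A) x

theorem continuous_snd_add_sdist (x : Sph k) :
    Continuous fun q : Ein k => q.2 + sdist x q.1 := by
  simp only [sdist_comm x]
  exact continuous_snd.add ((continuous_sdist_left x).comp continuous_fst)

/-- Needed because a real infimum takes a default value on a family that is not bounded below. -/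
theorem bddBelow_upperFun (hA : IsCompact A) (x : Sph k) :
    BddBelow (range fun q : A => q.1.2 + sdist x q.1.1) := by
  have h := (hA.image (continuous_snd_add_sdist x)).bddBelow
  rwa [image_eq_range] at h

theorem upperFun_le (hA : IsCompact A) (x : Sph k) {q : Ein k} (hq : q ∈ A) :
    upperFun A x ≤ q.2 + sdist x q.1 :=
  ciInf_le (bddBelow_upperFun hA x) ⟨q, hq⟩

theorem exists_upperFun_eq (hA : IsCompact A) (hne : A.Nonempty) (x : Sph k) :
    ∃ q ∈ A, upperFun A x = q.2 + sdist x q.1 := by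
  obtain ⟨q, hq, hmin⟩ := hA.exists_isMinOn hne (continuous_snd_add_sdist x).continuousOn
  have : Nonempty A := hne.to_subtype
  exact ⟨q, hq, le_antisymm (upperFun_le hA x hq) (le_ciInf fun r => hmin r.2)⟩

theorem abs_upperFun_sub_le (hA : IsCompact A) (hne : A.Nonempty) (x y : Sph k) :
    |upperFun A x - upperFun A y| ≤ sdist x y := by
  obtain ⟨q, hq, h1⟩ := exists_upperFun_eq hA hne x
  obtain ⟨r, hr, h2⟩ := exists_upperFun_eq hA hne y
  have h3 := upperFun_le hA y hq
  have h4 := upperFun_le hA x hr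
  have h5 := sdist_triangle x y r.1
  have h6 := sdist_triangle y x q.1
  rw [sdist_comm y x] at h6
  rw [abs_le]
  constructor <;> linarith

theorem continuous_of_abs_sub_le_sdist {f : Sph k → ℝ}
    (hf : ∀ x y, |f x - f y| ≤ sdist x y) : Continuous f := by
  refine continuous_iff_continuousAt.2 fun y => ?_
  have h0 : Tendsto (fun x => sdist x y) (𝓝 y) (𝓝 0) := by
    have := (continuous_sdist_left y).tendsto y
    rwa [sdist_self] at this
  refine tendsto_iff_dist_tendsto_zero.2 (squeeze_zero (fun _ => dist_nonneg) (fun x => ?_) h0)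
  rw [Real.dist_eq]
  exact hf x y

theorem continuous_upperFun (hA : IsCompact A) (hne : A.Nonempty) : Continuous (upperFun A) :=
  continuous_of_abs_sub_le_sdist (abs_upperFun_sub_le hA hne)

/-- Time reversal exchanges the two extremal functions, so each fact on `lowerFun` is read off from
one on `upperFun`. -/
theorem isCompact_reflect (hA : IsCompact A) :
    IsCompact ((fun p : Ein k => (p.1, -p.2)) '' A) := by
  have h : Continuous fun p : Ein k => ((p.1, -p.2) : Ein k) := by fun_prop
  exact hA.image h

theorem le_lowerFun (hA : IsCompact A) (x : Sph k) {q : Ein k} (hq : q ∈ A) :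
    q.2 - sdist x q.1 ≤ lowerFun A x := by
  have h := upperFun_le (isCompact_reflect hA) x (mem_image_of_mem _ hq)
  simp only at h
  unfold lowerFun
  linarith

theorem exists_lowerFun_eq (hA : IsCompact A) (hne : A.Nonempty) (x : Sph k) :
    ∃ q ∈ A, lowerFun A x = q.2 - sdist x q.1 := by
  obtain ⟨_, ⟨q, hq, rfl⟩, h⟩ := exists_upperFun_eq (isCompact_reflect hA) (hne.image _) x
  refine ⟨q, hq, ?_⟩
  simp only at h
  unfold lowerFun
  linarith

theorem continuous_lowerFun (hA : IsCompact A) (hne : A.Nonempty) : Continuous (lowerFun A) :=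
  (continuous_upperFun (isCompact_reflect hA) (hne.image _)).neg

theorem upperFun_anti {B : Set (Ein k)} (hB : IsCompact B) (hA : IsCompact A) (hne : A.Nonempty)
    (h : A ⊆ B) (x : Sph k) : upperFun B x ≤ upperFun A x := by
  obtain ⟨q, hq, he⟩ := exists_upperFun_eq hA hne x
  rw [he]
  exact upperFun_le hB x (h hq)

theorem lowerFun_mono {B : Set (Ein k)} (hB : IsCompact B) (hA : IsCompact A) (hne : A.Nonempty)
    (h : A ⊆ B) (x : Sph k) : lowerFun A x ≤ lowerFun B x := by
  obtain ⟨q, hq, he⟩ := exists_lowerFun_eq hA hne x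
  rw [he]
  exact le_lowerFun hB x (h hq)

/-- The extrema are attained on the compact set `A`, so strict inequalities against every point of
`A` amount to strict inequalities against the two functions. -/
theorem mem_invisibleDomain_iff_lt (hk : 2 ≤ k) (hA : IsCompact A) (hne : A.Nonempty) {p : Ein k} :
    p ∈ invisibleDomain A ↔ lowerFun A p.1 < p.2 ∧ p.2 < upperFun A p.1 := by
  rw [mem_invisibleDomain_iff hk]
  constructor
  · intro h
    obtain ⟨q, hq, h1⟩ := exists_upperFun_eq hA hne p.1
    obtain ⟨r, hr, h2⟩ := exists_lowerFun_eq hA hne p.1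
    have h3 := abs_lt.1 (h q hq)
    have h4 := abs_lt.1 (h r hr)
    constructor <;> linarith
  · rintro ⟨h1, h2⟩ q hq
    have h3 := upperFun_le hA p.1 hq
    have h4 := le_lowerFun hA p.1 hq
    rw [abs_lt]
    constructor <;> linarith

theorem isOpen_invisibleDomain (hk : 2 ≤ k) (hA : IsCompact A) (hne : A.Nonempty) :
    IsOpen (invisibleDomain A) := by
  have h : invisibleDomain A = {p | lowerFun A p.1 < p.2} ∩ {p | p.2 < upperFun A p.1} :=
    Set.ext fun p => mem_invisibleDomain_iff_lt hk hA hne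
  rw [h]
  exact (isOpen_lt ((continuous_lowerFun hA hne).comp continuous_fst) continuous_snd).inter
    (isOpen_lt continuous_snd ((continuous_upperFun hA hne).comp continuous_fst))

end Extremal

/-! ### The equator as an isometric subsphere. -/

section Equator

variable {k : ℕ}

theorem equator_castSucc (x : Sph k) (j : Fin k) :
    (equator x : EuclideanSpace ℝ (Fin (k + 1))) j.castSucc = (x : EuclideanSpace ℝ (Fin k)) j := by
  simp [equator]

theorem equator_last (x : Sph k) :
    (equator x : EuclideanSpace ℝ (Fin (k + 1))) (Fin.last k) = 0 := by
  simp [equator]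

theorem sdist_equator (x y : Sph k) : sdist (equator x) (equator y) = sdist x y := by
  rw [sdist_eq_arccos, sdist_eq_arccos, PiLp.inner_apply, PiLp.inner_apply, Fin.sum_univ_castSucc]
  simp only [equator_castSucc, equator_last, inner_zero_left, add_zero]

theorem continuous_equator : Continuous (equator (k := k)) := by
  refine continuous_induced_rng.2 ((PiLp.continuous_toLp 2 _).comp (continuous_pi fun j => ?_))
  refine Fin.lastCases ?_ (fun j => ?_) j
  · simpa using continuous_const
  · simp only [Fin.snoc_castSucc]
    exact (PiLp.continuous_apply 2 _ j).comp continuous_subtype_val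

theorem continuous_einIncl : Continuous (einIncl (k := k)) :=
  (continuous_equator.comp continuous_fst).prodMk continuous_snd

theorem equator_neg (x : Sph k) : equator (-x) = -equator x := by
  apply Subtype.ext
  ext j
  refine Fin.lastCases ?_ (fun j => ?_) j
  · rw [equator_last]
    exact (neg_eq_zero.2 (equator_last x)).symm
  · rw [equator_castSucc]
    exact congrArg Neg.neg (equator_castSucc x j).symm

/-- Equality in the triangle inequality forces `y` into the span of the two equatorial points,
unless these are antipodal; a point off the equator is not in that span. -/
theorem sdist_lt_add_of_height {y : Sph (k + 1)}
    (hy : (y : EuclideanSpace ℝ (Fin (k + 1))) (Fin.last k) ≠ 0) {x x' : Sph k}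
    (h : sdist x x' ≠ Real.pi) : sdist x x' < sdist y (equator x) + sdist y (equator x') := by
  rw [← sdist_equator] at *
  rw [sdist_comm y (equator x)]
  refine lt_of_le_of_ne (sdist_triangle _ _ _) fun he => ?_
  rcases (InnerProductGeometry.angle_eq_angle_add_angle_iff (sph_ne_zero y)).1 he with h' | h'
  · exact h h'
  · obtain ⟨a, b, hab⟩ := Submodule.mem_span_pair.1 h'
    have := congrArg (fun v : EuclideanSpace ℝ (Fin (k + 1)) => v (Fin.last k)) hab
    simp only [PiLp.add_apply, PiLp.smul_apply, equator_last, smul_zero, add_zero] at this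
    exact hy this.symm

/-- The equator is isometrically embedded, so the extremal functions restrict to those of the
smaller universe. The boundary part of the invisible domain can thus be described inside `Ein k`. -/
theorem upperFun_equator {A : Set (Ein k)} (hA : IsCompact A) (hne : A.Nonempty) (x : Sph k) :
    upperFun (einIncl '' A) (equator x) = upperFun A x := by
  have hA' := hA.image continuous_einIncl
  apply le_antisymm
  · obtain ⟨q, hq, h⟩ := exists_upperFun_eq hA hne x
    have := upperFun_le hA' (equator x) (mem_image_of_mem einIncl hq)
    simpa only [einIncl, sdist_equator, ← h] using this
  · obtain ⟨_, ⟨q, hq, rfl⟩, h⟩ := exists_upperFun_eq hA' (hne.image _) (equator x)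
    rw [h]
    simpa only [einIncl, sdist_equator] using upperFun_le hA x hq

theorem lowerFun_equator {A : Set (Ein k)} (hA : IsCompact A) (hne : A.Nonempty) (x : Sph k) :
    lowerFun (einIncl '' A) (equator x) = lowerFun A x := by
  have hA' := hA.image continuous_einIncl
  apply le_antisymm
  · obtain ⟨_, ⟨q, hq, rfl⟩, h⟩ := exists_lowerFun_eq hA' (hne.image _) (equator x)
    rw [h]
    simpa only [einIncl, sdist_equator] using le_lowerFun hA x hq
  · obtain ⟨q, hq, h⟩ := exists_lowerFun_eq hA hne x
    have := le_lowerFun hA' (equator x) (mem_image_of_mem einIncl hq)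
    simpa only [einIncl, sdist_equator, ← h] using this

end Equator

/-! ### Regular domains, the points that do not see the boundary, and the horizon. -/

section RegularDomain

variable {n : ℕ} {A : Set (Ein n)}

/-- The part of the invisible domain of `A` in the conformal boundary. -/
def boundaryDomain (A : Set (Ein n)) : Set (Ein (n + 1)) :=
  invisibleDomain (einIncl '' A) ∩ range einIncl

/-- The points of the regular domain whose future avoids the conformal boundary. -/
def unseeingSet (i : Fin 2) (A : Set (Ein n)) : Set (Ein (n + 1)) :=
  {p | p ∈ regularDomain i A ∧ ∀ q ∈ boundaryDomain A, ¬ CausalLE p q}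

theorem height_ne_zero {i : Fin 2} {p : Ein (n + 1)} (hp : p ∈ adsCopy n i) : height p ≠ 0 := by
  intro h
  have h' : 0 < (-1 : ℝ) ^ (i : ℕ) * height p := hp
  rw [h, mul_zero] at h'
  exact lt_irrefl _ h'

theorem continuous_height : Continuous (height (k := n)) :=
  (PiLp.continuous_apply 2 _ _).comp (continuous_subtype_val.comp continuous_fst)

theorem isOpen_adsCopy (i : Fin 2) : IsOpen (adsCopy n i) :=
  isOpen_lt continuous_const (continuous_const.mul continuous_height)

/-- Acausality makes time strictly 1-Lipschitz on `A`, so at a point of `A` no other point of `A`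
gives a smaller value. -/
theorem upperFun_eq_of_mem (hn : 2 ≤ n) (hA : IsCompact A) (hac : IsAcausal A) {q : Ein n}
    (hq : q ∈ A) : upperFun A q.1 = q.2 := by
  apply le_antisymm
  · simpa [sdist_self] using upperFun_le hA q.1 hq
  · obtain ⟨r, hr, h⟩ := exists_upperFun_eq hA ⟨q, hq⟩ q.1
    by_cases hqr : q = r
    · rw [h, ← hqr, sdist_self, add_zero]
    · have := (abs_lt.1 ((isAcausal_iff hn).1 hac q hq r hr hqr)).2
      linarith

theorem subset_upperGraph (hn : 2 ≤ n) (hA : IsCompact A) (hac : IsAcausal A) :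
    A ⊆ upperGraph A := fun _ hq => (upperFun_eq_of_mem hn hA hac hq).symm

theorem isCompact_upperGraph (hA : IsCompact A) (hne : A.Nonempty) : IsCompact (upperGraph A) := by
  have h : upperGraph A = (fun x => (x, upperFun A x)) '' univ := by
    ext ⟨x, t⟩
    simp only [upperGraph, mem_ofPred_eq, image_univ, mem_range, Prod.mk.injEq, exists_eq_left]
    exact eq_comm
  rw [h]
  exact isCompact_univ.image (continuous_id.prodMk (continuous_upperFun hA hne))

theorem upperGraph_nonempty (hne : A.Nonempty) : (upperGraph A).Nonempty :=
  hne.elim fun q _ => ⟨(q.1, upperFun A q.1), rfl⟩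

/-- The infimum against the distance is idempotent, by the triangle inequality. Replacing `A` by
`upperGraph A` therefore only raises the lower edge of the regular domain. -/
theorem upperFun_upperGraph (hn : 2 ≤ n) (hA : IsCompact A) (hac : IsAcausal A) (hne : A.Nonempty)
    (y : Sph (n + 1)) :
    upperFun (einIncl '' upperGraph A) y = upperFun (einIncl '' A) y := by
  have hA' := hA.image continuous_einIncl
  have hG' := (isCompact_upperGraph hA hne).image continuous_einIncl
  apply le_antisymm
  · exact upperFun_anti hG' hA' (hne.image _) (image_mono (subset_upperGraph hn hA hac)) y
  · obtain ⟨_, ⟨r, hr, rfl⟩, h⟩ := exists_upperFun_eq hG' ((upperGraph_nonempty hne).image _) y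
    obtain ⟨q, hq, h'⟩ := exists_upperFun_eq hA hne r.1
    have hr' : r.2 = upperFun A r.1 := hr
    have h1 := upperFun_le hA' y (mem_image_of_mem einIncl hq)
    have h2 := sdist_triangle y (equator r.1) (equator q.1)
    rw [sdist_equator] at h2
    simp only [einIncl] at h h1
    linarith

/-- Compare points of `A` realizing the two extrema. If they coincide, the gap is twice a positive
distance; if not, acausality and the triangle inequality make it positive. -/
theorem lowerFun_lt_upperFun_of_notMem (hn : 2 ≤ n) (hA : IsCompact A) (hac : IsAcausal A)
    (hne : A.Nonempty) {x : Sph n} (hx : ∀ q ∈ A, q.1 ≠ x) : lowerFun A x < upperFun A x := by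
  obtain ⟨q, hq, h1⟩ := exists_upperFun_eq hA hne x
  obtain ⟨r, hr, h2⟩ := exists_lowerFun_eq hA hne x
  rw [h1, h2]
  by_cases hqr : q = r
  · have h3 : sdist x q.1 ≠ 0 := fun h => hx q hq (eq_of_sdist_eq_zero h).symm
    have h4 := lt_of_le_of_ne (sdist_nonneg x q.1) h3.symm
    rw [← hqr]
    linarith
  · have h3 := (abs_lt.1 ((isAcausal_iff hn).1 hac q hq r hr hqr)).1
    have h4 := sdist_triangle q.1 x r.1
    rw [sdist_comm q.1 x] at h4
    linarith

theorem mem_regularDomain_iff (hn : 2 ≤ n) (hA : IsCompact A) (hne : A.Nonempty) {i : Fin 2}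
    {p : Ein (n + 1)} : p ∈ regularDomain i A ↔ p ∈ adsCopy n i ∧
      lowerFun (einIncl '' A) p.1 < p.2 ∧ p.2 < upperFun (einIncl '' A) p.1 :=
  and_congr_right fun _ => mem_invisibleDomain_iff_lt (by omega) (hA.image continuous_einIncl)
    (hne.image _)

theorem mem_regularDomain_upperGraph_iff (hn : 2 ≤ n) (hA : IsCompact A) (hac : IsAcausal A)
    (hne : A.Nonempty) {i : Fin 2} {p : Ein (n + 1)} :
    p ∈ regularDomain i (upperGraph A) ↔
      p ∈ regularDomain i A ∧ lowerFun (einIncl '' upperGraph A) p.1 < p.2 := by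
  rw [mem_regularDomain_iff hn (isCompact_upperGraph hA hne) (upperGraph_nonempty hne),
    mem_regularDomain_iff hn hA hne, upperFun_upperGraph hn hA hac hne]
  constructor
  · rintro ⟨h1, h2, h3⟩
    exact ⟨⟨h1, lt_of_le_of_lt (lowerFun_mono
      ((isCompact_upperGraph hA hne).image continuous_einIncl) (hA.image continuous_einIncl)
      (hne.image _) (image_mono (subset_upperGraph hn hA hac)) _) h2, h3⟩, h2⟩
  · rintro ⟨⟨h1, -, h3⟩, h2⟩
    exact ⟨h1, h2, h3⟩

/-- Boundary points of the invisible domain lie strictly below the upper graph, so a point on or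
above the lower function of that graph cannot reach them. Below it, the light cone passes strictly
under the upper graph at some `r`, and a boundary point over `r`, slightly below the graph, is in
the future. -/
theorem mem_unseeingSet_iff (hn : 2 ≤ n) (hA : IsCompact A) (hac : IsAcausal A)
    (hne : A.Nonempty) {i : Fin 2} {p : Ein (n + 1)} :
    p ∈ unseeingSet i A ↔
      p ∈ regularDomain i A ∧ lowerFun (einIncl '' upperGraph A) p.1 ≤ p.2 := by
  have hA' := hA.image continuous_einIncl
  have hG' := (isCompact_upperGraph hA hne).image continuous_einIncl
  refine and_congr_right fun hp => ⟨fun h => ?_, ?_⟩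
  · by_contra! hlt
    obtain ⟨_, ⟨r, hr, rfl⟩, h1⟩ := exists_lowerFun_eq hG' ((upperGraph_nonempty hne).image _) p.1
    have hr' : r.2 = upperFun A r.1 := hr
    rw [h1] at hlt
    simp only [einIncl] at hlt
    -- A point of `A` over `r.1` would be `r` itself, and then `p` would lie in the past of `A`.
    have hnot : ∀ q ∈ A, q.1 ≠ r.1 := by
      intro q hq hqr
      have h2 := le_lowerFun hA' p.1 (mem_image_of_mem einIncl hq)
      have h3 := ((mem_regularDomain_iff hn hA hne).1 hp).2.1
      have h4 := upperFun_eq_of_mem hn hA hac hq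
      simp only [einIncl, hqr] at h2 h4
      linarith
    have hgap := lowerFun_lt_upperFun_of_notMem hn hA hac hne hnot
    -- The time `t` must be above the lower function, to be invisible from `A`, above the light cone
    -- of `p`, to be in its future, and still below the upper graph.
    obtain ⟨t, ht1, ht2⟩ := exists_between
      (max_lt hgap (show p.2 + sdist p.1 (equator r.1) < upperFun A r.1 by linarith))
    obtain ⟨ht3, ht4⟩ := max_lt_iff.1 ht1
    refine h (einIncl (r.1, t)) ⟨?_, mem_range_self _⟩ ?_
    · rw [mem_invisibleDomain_iff_lt (by omega) hA' (hne.image _)]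
      simp only [einIncl]
      rw [upperFun_equator hA hne, lowerFun_equator hA hne]
      exact ⟨ht3, ht2⟩
    · rw [causalLE_iff (by omega)]
      simp only [einIncl]
      linarith
  · rintro hle _ ⟨hq, ⟨q, rfl⟩⟩ hpq
    rw [mem_invisibleDomain_iff_lt (by omega) hA' (hne.image _)] at hq
    simp only [einIncl] at hq
    rw [upperFun_equator hA hne, lowerFun_equator hA hne] at hq
    rw [causalLE_iff (by omega)] at hpq
    have h1 := le_lowerFun hG' p.1 (mem_image_of_mem einIncl
      (show (q.1, upperFun A q.1) ∈ upperGraph A from rfl))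
    simp only [einIncl] at hpq h1
    linarith

theorem continuous_lowerFun_upperGraph (hA : IsCompact A) (hne : A.Nonempty) :
    Continuous (lowerFun (einIncl '' upperGraph A)) :=
  continuous_lowerFun ((isCompact_upperGraph hA hne).image continuous_einIncl)
    ((upperGraph_nonempty hne).image _)

theorem isOpen_regularDomain (hn : 2 ≤ n) (hA : IsCompact A) (hne : A.Nonempty) (i : Fin 2) :
    IsOpen (regularDomain i A) :=
  (isOpen_adsCopy i).inter
    (isOpen_invisibleDomain (by omega) (hA.image continuous_einIncl) (hne.image _))

theorem tendsto_shift (p : Ein n) :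
    Tendsto (fun ε : ℝ => ((p.1, p.2 + ε) : Ein n)) (𝓝 0) (𝓝 p) := by
  have h : Continuous fun ε : ℝ => ((p.1, p.2 + ε) : Ein n) := by fun_prop
  simpa using h.tendsto 0

/-- A point on the graph of the lower function leaves the set when moved slightly down in time, so
passing to the interior turns the weak inequality into a strict one. -/
theorem interior_unseeingSet (hn : 2 ≤ n) (hA : IsCompact A) (hac : IsAcausal A)
    (hne : A.Nonempty) (i : Fin 2) :
    interior (unseeingSet i A) = regularDomain i (upperGraph A) := by
  apply Subset.antisymm
  · intro p hp
    rw [mem_regularDomain_upperGraph_iff hn hA hac hne]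
    have hp' := (mem_unseeingSet_iff hn hA hac hne).1 (interior_subset hp)
    refine ⟨hp'.1, ?_⟩
    have h1 : ∀ᶠ ε : ℝ in 𝓝[<] 0, ((p.1, p.2 + ε) : Ein (n + 1)) ∈ unseeingSet i A :=
      ((tendsto_shift p).mono_left nhdsWithin_le_nhds).eventually (mem_interior_iff_mem_nhds.1 hp)
    obtain ⟨ε, hε, hlt⟩ := (h1.and self_mem_nhdsWithin).exists
    have h2 := ((mem_unseeingSet_iff hn hA hac hne).1 hε).2
    simp only at h2
    linarith
  · refine interior_maximal (fun p hp => ?_)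
      (isOpen_regularDomain hn (isCompact_upperGraph hA hne) (upperGraph_nonempty hne) i)
    rw [mem_regularDomain_upperGraph_iff hn hA hac hne] at hp
    exact (mem_unseeingSet_iff hn hA hac hne).2 ⟨hp.1, hp.2.le⟩

/-- Points where the inequality is an equality are limits of their upward translates in time, which
lie in the open regular domain of the upper graph; conversely the weak inequality is a closed
condition. -/
theorem unseeingSet_eq (hn : 2 ≤ n) (hA : IsCompact A) (hac : IsAcausal A)
    (hne : A.Nonempty) (i : Fin 2) :
    unseeingSet i A = regularDomain i (upperGraph A) ∪
      (frontier (regularDomain i (upperGraph A)) ∩ regularDomain i A) := by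
  have hopen := isOpen_regularDomain hn (isCompact_upperGraph hA hne) (upperGraph_nonempty hne) i
  apply Subset.antisymm
  · intro p hp
    obtain ⟨h1, h2⟩ := (mem_unseeingSet_iff hn hA hac hne).1 hp
    by_cases hB : p ∈ regularDomain i (upperGraph A)
    · exact Or.inl hB
    refine Or.inr ⟨?_, h1⟩
    rw [hopen.frontier_eq]
    refine ⟨?_, hB⟩
    have e1 : ∀ᶠ ε : ℝ in 𝓝[>] 0, ((p.1, p.2 + ε) : Ein (n + 1)) ∈ regularDomain i A :=
      ((tendsto_shift p).mono_left nhdsWithin_le_nhds).eventually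
        ((isOpen_regularDomain hn hA hne i).mem_nhds h1)
    refine mem_closure_of_tendsto ((tendsto_shift p).mono_left (nhdsWithin_le_nhds (s := Ioi 0))) ?_
    filter_upwards [e1, self_mem_nhdsWithin] with ε h3 h4
    rw [mem_regularDomain_upperGraph_iff hn hA hac hne]
    refine ⟨h3, ?_⟩
    simp only [mem_Ioi] at h4 ⊢
    linarith
  · rintro p (hp | ⟨hp, hp'⟩)
    · exact interior_subset ((interior_unseeingSet hn hA hac hne i).symm ▸ hp)
    · refine (mem_unseeingSet_iff hn hA hac hne).2 ⟨hp', ?_⟩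
      refine closure_minimal (t := {p : Ein (n + 1) |
        lowerFun (einIncl '' upperGraph A) p.1 ≤ p.2}) (fun q hq => ?_)
        (isClosed_le ((continuous_lowerFun_upperGraph hA hne).comp continuous_fst) continuous_snd)
        (frontier_subset_closure hp)
      exact ((mem_regularDomain_upperGraph_iff hn hA hac hne).1 hq).2.le

/-- Over any point of the equator missed by `A` there is a gap, hence a boundary point. If no point
were missed, `A` would be the graph of the continuous function `upperFun A`, hence homeomorphic to
the sphere. -/
theorem boundaryDomain_nonempty (hn : 2 ≤ n) (hA : IsCompact A) (hac : IsAcausal A)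
    (hne : A.Nonempty) (hsphere : ¬ Nonempty (A ≃ₜ Sph n)) : (boundaryDomain A).Nonempty := by
  by_contra hempty
  refine hsphere ?_
  have hsurj : ∀ x : Sph n, ∃ q ∈ A, q.1 = x := by
    by_contra! h
    obtain ⟨x, hx⟩ := h
    obtain ⟨t, ht1, ht2⟩ := exists_between (lowerFun_lt_upperFun_of_notMem hn hA hac hne hx)
    refine hempty ⟨einIncl (x, t), ?_, mem_range_self _⟩
    rw [mem_invisibleDomain_iff_lt (by omega) (hA.image continuous_einIncl) (hne.image _)]
    simp only [einIncl]
    rw [upperFun_equator hA hne, lowerFun_equator hA hne]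
    exact ⟨ht1, ht2⟩
  have hmem : ∀ x, (x, upperFun A x) ∈ A := by
    intro x
    obtain ⟨q, hq, rfl⟩ := hsurj x
    rw [upperFun_eq_of_mem hn hA hac hq]
    exact hq
  exact ⟨
    { toFun := fun q => q.1.1
      invFun := fun x => ⟨(x, upperFun A x), hmem x⟩
      left_inv := fun q => Subtype.ext
        (Prod.ext rfl (upperFun_eq_of_mem hn hA hac q.2))
      right_inv := fun _ => rfl
      continuous_toFun := continuous_fst.comp continuous_subtype_val
      continuous_invFun :=
        (continuous_id.prodMk (continuous_upperFun hA hne)).subtype_mk _ }⟩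

/-- The open hemisphere over which a copy of anti-de Sitter space lies. -/
def hemisphere (n : ℕ) (i : Fin 2) : Set (Sph (n + 1)) :=
  {y | 0 < (-1 : ℝ) ^ (i : ℕ) * (y : EuclideanSpace ℝ (Fin (n + 1))) (Fin.last n)}

/-- The radial projection of a convex open half-space. -/
theorem isPreconnected_hemisphere (n : ℕ) (i : Fin 2) : IsPreconnected (hemisphere n i) := by
  set H : Set (EuclideanSpace ℝ (Fin (n + 1))) :=
    {v | 0 < (-1 : ℝ) ^ (i : ℕ) * v (Fin.last n)} with hH
  have hconv : Convex ℝ H := by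
    intro v hv w hw a b ha hb hab
    have hv' : 0 < (-1 : ℝ) ^ (i : ℕ) * v (Fin.last n) := hv
    have hw' : 0 < (-1 : ℝ) ^ (i : ℕ) * w (Fin.last n) := hw
    change 0 < (-1 : ℝ) ^ (i : ℕ) * (a * v (Fin.last n) + b * w (Fin.last n))
    have h : (-1 : ℝ) ^ (i : ℕ) * (a * v (Fin.last n) + b * w (Fin.last n)) =
        a * ((-1 : ℝ) ^ (i : ℕ) * v (Fin.last n)) + b * ((-1 : ℝ) ^ (i : ℕ) * w (Fin.last n)) := by
      ring
    rw [h]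
    rcases ha.eq_or_lt with rfl | ha
    · obtain rfl : b = 1 := by linarith
      linarith
    · have := mul_pos ha hv'
      have := mul_nonneg hb hw'.le
      linarith
  have hne : ∀ v : H, (v : EuclideanSpace ℝ (Fin (n + 1))) ≠ 0 := by
    rintro ⟨v, hv⟩ rfl
    simp [hH] at hv
  have : PreconnectedSpace H := isPreconnected_iff_preconnectedSpace.1 hconv.isPreconnected
  let f : H → Sph (n + 1) := fun v => ⟨‖(v : EuclideanSpace ℝ (Fin (n + 1)))‖⁻¹ • v, by
    rw [mem_sphere_zero_iff_norm, norm_smul, norm_inv, norm_norm,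
      inv_mul_cancel₀ (norm_ne_zero_iff.2 (hne v))]⟩
  have hf : Continuous f :=
    (((continuous_norm.comp continuous_subtype_val).inv₀
      fun v => norm_ne_zero_iff.2 (hne v)).smul continuous_subtype_val).subtype_mk _
  have hr : hemisphere n i = range f := by
    ext y
    constructor
    · intro hy
      refine ⟨⟨y, hy⟩, Subtype.ext ?_⟩
      simp [f]
    · rintro ⟨v, rfl⟩
      have h1 : 0 < (-1 : ℝ) ^ (i : ℕ) * (v : EuclideanSpace ℝ (Fin (n + 1))) (Fin.last n) := v.2
      have h2 : 0 < ‖(v : EuclideanSpace ℝ (Fin (n + 1)))‖⁻¹ :=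
        inv_pos.2 (norm_pos_iff.2 (hne v))
      change 0 < (-1 : ℝ) ^ (i : ℕ) * (‖(v : EuclideanSpace ℝ (Fin (n + 1)))‖⁻¹ *
        (v : EuclideanSpace ℝ (Fin (n + 1))) (Fin.last n))
      have := mul_pos h2 h1
      linarith
  rw [hr]
  exact isPreconnected_range hf

theorem hemisphere_nonempty (n : ℕ) (i : Fin 2) : (hemisphere n i).Nonempty := by
  refine ⟨⟨EuclideanSpace.single (Fin.last n) ((-1 : ℝ) ^ (i : ℕ)), by simp⟩, ?_⟩
  change 0 < (-1 : ℝ) ^ (i : ℕ) *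
    (EuclideanSpace.single (Fin.last n) ((-1 : ℝ) ^ (i : ℕ)) : EuclideanSpace ℝ (Fin (n + 1))) (Fin.last n)
  rw [PiLp.single_apply, if_pos rfl, ← mul_pow]
  norm_num

/-- With `q` in `A` and `r` in the upper graph realizing the two extrema, the weak inequality is the
triangle inequality through `y`. It is strict off the equator unless `r` and `q` are antipodal. -/
theorem lowerFun_upperGraph_lt (hn : 2 ≤ n) (hA : IsCompact A) (hac : IsAcausal A)
    (hnt : A.Nontrivial) {i : Fin 2} {y : Sph (n + 1)} (hy : y ∈ hemisphere n i) :
    lowerFun (einIncl '' upperGraph A) y < upperFun (einIncl '' A) y := by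
  have hne := hnt.nonempty
  have hy' : (y : EuclideanSpace ℝ (Fin (n + 1))) (Fin.last n) ≠ 0 :=
    height_ne_zero (p := (y, 0)) (i := i) hy
  obtain ⟨_, ⟨q, hq, rfl⟩, h1⟩ :=
    exists_upperFun_eq (hA.image continuous_einIncl) (hne.image _) y
  obtain ⟨_, ⟨r, hr, rfl⟩, h2⟩ :=
    exists_lowerFun_eq ((isCompact_upperGraph hA hne).image continuous_einIncl)
      ((upperGraph_nonempty hne).image _) y
  have hr' : r.2 = upperFun A r.1 := hr
  rw [h1, h2]
  simp only [einIncl]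
  have h3 := upperFun_le hA r.1 hq
  by_cases hpi : sdist r.1 q.1 = Real.pi
  · obtain ⟨q', hq', hqq⟩ := hnt.exists_ne q
    have h4 := (abs_lt.1 ((isAcausal_iff hn).1 hac q' hq' q hq hqq)).2
    have h5 := upperFun_le hA r.1 hq'
    have h6 : r.1 = -q.1 := eq_of_sdist_eq_zero (by rw [sdist_neg_right, hpi, sub_self])
    have h7 := sdist_triangle (equator r.1) y (equator q.1)
    rw [sdist_equator, sdist_comm (equator r.1)] at h7
    rw [h6, sdist_neg_left, sdist_comm q.1 q'.1] at h5
    rw [h6] at h7 hr' ⊢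
    rw [sdist_neg_left, sdist_self] at h7
    linarith
  · have h4 := sdist_lt_add_of_height hy' hpi
    linarith

/-- For a single point the upper graph is the light cone refocusing at the antipode after time `π`.
The past cone of that antipode is the future cone of the point, so nothing remains between the two
graphs. -/
theorem upperFun_le_lowerFun_upperGraph (hA : IsCompact A) {q : Ein n}
    (hq : A = {q}) (y : Sph (n + 1)) :
    upperFun (einIncl '' A) y ≤ lowerFun (einIncl '' upperGraph A) y := by
  have hne : A.Nonempty := hq ▸ singleton_nonempty q
  obtain ⟨r, hr, h⟩ := exists_upperFun_eq hA hne (-q.1)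
  have hrq : r = q := by rw [hq] at hr; exact hr
  rw [hrq, sdist_neg_left, sdist_self] at h
  have h1 := le_lowerFun ((isCompact_upperGraph hA hne).image continuous_einIncl) y
    (mem_image_of_mem einIncl (show (-q.1, upperFun A (-q.1)) ∈ upperGraph A from rfl))
  have h2 := upperFun_le (hA.image continuous_einIncl) y
    (mem_image_of_mem einIncl (hq ▸ mem_singleton q : q ∈ A))
  simp only [einIncl] at h1 h2
  rw [equator_neg, sdist_neg_right] at h1
  linarith

theorem regularDomain_upperGraph_nonempty (hn : 2 ≤ n) (hA : IsCompact A) (hac : IsAcausal A)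
    (hnt : A.Nontrivial) (i : Fin 2) : (regularDomain i (upperGraph A)).Nonempty := by
  obtain ⟨y, hy⟩ := hemisphere_nonempty n i
  obtain ⟨t, ht1, ht2⟩ := exists_between (lowerFun_upperGraph_lt hn hA hac hnt hy)
  refine ⟨(y, t), (mem_regularDomain_iff hn (isCompact_upperGraph hA hnt.nonempty)
    (upperGraph_nonempty hnt.nonempty)).2 ⟨hy, ht1, ?_⟩⟩
  rw [upperFun_upperGraph hn hA hac hnt.nonempty]
  exact ht2

theorem isPreconnected_regularDomain_upperGraph (hn : 2 ≤ n) (hA : IsCompact A)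
    (hac : IsAcausal A) (hne : A.Nonempty) (i : Fin 2) :
    IsPreconnected (regularDomain i (upperGraph A)) := by
  have hmem : ∀ p : Ein (n + 1), p ∈ regularDomain i (upperGraph A) ↔ p.1 ∈ hemisphere n i ∧
      lowerFun (einIncl '' upperGraph A) p.1 < p.2 ∧ p.2 < upperFun (einIncl '' A) p.1 := by
    intro p
    rw [mem_regularDomain_iff hn (isCompact_upperGraph hA hne) (upperGraph_nonempty hne),
      upperFun_upperGraph hn hA hac hne]
    rfl
  rcases hne.exists_eq_singleton_or_nontrivial with ⟨q, hq⟩ | hnt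
  · have : regularDomain i (upperGraph A) = ∅ := by
      refine eq_empty_of_forall_notMem fun p hp => ?_
      have h1 := (hmem p).1 hp
      have h2 := upperFun_le_lowerFun_upperGraph hA hq p.1
      linarith
    rw [this]
    exact isPreconnected_empty
  · set G := lowerFun (einIncl '' upperGraph A)
    set F := upperFun (einIncl '' A)
    have hG : Continuous G := continuous_lowerFun_upperGraph hA hne
    have hF : Continuous F := continuous_upperFun (hA.image continuous_einIncl) (hne.image _)
    -- Linear interpolation between the two graphs turns the region into the image of a product of
    -- connected sets.
    have him : regularDomain i (upperGraph A) =
        (fun p : Sph (n + 1) × ℝ => ((p.1, G p.1 + p.2 * (F p.1 - G p.1)) : Ein (n + 1))) ''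
          (hemisphere n i ×ˢ Ioo 0 1) := by
      ext p
      rw [hmem]
      constructor
      · rintro ⟨h1, h2, h3⟩
        have h4 : 0 < F p.1 - G p.1 := by linarith
        refine ⟨(p.1, (p.2 - G p.1) / (F p.1 - G p.1)), ⟨h1, div_pos (by linarith) h4,
          (div_lt_one h4).2 (by linarith)⟩, Prod.ext rfl ?_⟩
        simp only
        field_simp
        ring
      · rintro ⟨⟨y, τ⟩, ⟨h1, h2, h3⟩, rfl⟩
        have h4 : 0 < F y - G y := sub_pos.2 (lowerFun_upperGraph_lt hn hA hac hnt h1)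
        simp only at h1 h2 h3 ⊢
        refine ⟨h1, ?_, ?_⟩ <;> nlinarith
    rw [him]
    refine ((isPreconnected_hemisphere n i).prod isPreconnected_Ioo).image _
      (Continuous.continuousOn ?_)
    have h1 : Continuous fun p : Sph (n + 1) × ℝ => G p.1 := hG.comp continuous_fst
    have h2 : Continuous fun p : Sph (n + 1) × ℝ => F p.1 := hF.comp continuous_fst
    exact continuous_fst.prodMk (h1.add (continuous_snd.mul (h2.sub h1)))

end RegularDomain

/-! ### Isometries of the quadratic form and the sign of `negDet`. -/

section LinearAlgebra

variable {m : ℕ}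

/-- The determinant of the negative parts of two vectors. -/
def negDet (v w : V m) : ℝ := v (Sum.inl 0) * w (Sum.inl 1) - v (Sum.inl 1) * w (Sum.inl 0)

theorem form_smul_smul (a b : ℝ) (v w : V m) : form (a • v) (b • w) = a * b * form v w := by
  simp only [form, Pi.smul_apply, smul_eq_mul, Fin.sum_univ_two, mul_add, Finset.mul_sum, mul_neg]
  congr 1
  · ring
  · exact Finset.sum_congr rfl fun _ _ => by ring

theorem negDet_smul_smul (a b : ℝ) (v w : V m) : negDet (a • v) (b • w) = a * b * negDet v w := by
  simp only [negDet, Pi.smul_apply, smul_eq_mul]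
  ring

theorem form_smul_sub_smul (a b : ℝ) (v w : V m) :
    form (a • v - b • w) (a • v - b • w) =
      a ^ 2 * form v v - 2 * a * b * form v w + b ^ 2 * form w w := by
  simp only [form, Pi.sub_apply, Pi.smul_apply, smul_eq_mul, Fin.sum_univ_two, mul_add,
    Finset.mul_sum, mul_neg]
  have h : ∑ i : Fin m, (a * v (Sum.inr i) - b * w (Sum.inr i)) *
      (a * v (Sum.inr i) - b * w (Sum.inr i)) =
      ∑ i : Fin m, a ^ 2 * (v (Sum.inr i) * v (Sum.inr i)) -
      ∑ i : Fin m, 2 * a * b * (v (Sum.inr i) * w (Sum.inr i)) +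
      ∑ i : Fin m, b ^ 2 * (w (Sum.inr i) * w (Sum.inr i)) := by
    rw [← Finset.sum_sub_distrib, ← Finset.sum_add_distrib]
    exact Finset.sum_congr rfl fun _ _ => by ring
  rw [h]
  ring

theorem eq_zero_of_form_nonpos {v : V m} (h0 : v (Sum.inl 0) = 0) (h1 : v (Sum.inl 1) = 0)
    (h : form v v ≤ 0) : v = 0 := by
  simp only [form, Fin.sum_univ_two, h0, h1, mul_zero, add_zero, neg_zero, zero_add] at h
  have hs : ∑ j : Fin m, v (Sum.inr j) * v (Sum.inr j) = 0 :=
    le_antisymm h (Finset.sum_nonneg fun _ _ => mul_self_nonneg _)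
  rw [Finset.sum_eq_zero_iff_of_nonneg fun _ _ => mul_self_nonneg _] at hs
  ext (a | j)
  · fin_cases a
    · exact h0
    · exact h1
  · exact mul_self_eq_zero.1 (hs j (Finset.mem_univ j))

theorem eq_zero_of_mulVec_eq_zero {B : Mat m} (hB : B ∈ O m) {v : V m} (h : B *ᵥ v = 0) :
    v = 0 := by
  -- Pairing `v` with the vector obtained by changing the sign of its negative part gives its
  -- squared Euclidean norm.
  have h1 := hB v (Sum.elim (fun a => -v (Sum.inl a)) (fun j => v (Sum.inr j)))
  have h2 := hB v v
  rw [h] at h1 h2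
  simp only [form, Fin.sum_univ_two, Sum.elim_inl, Sum.elim_inr, Pi.zero_apply, zero_mul,
    Finset.sum_const_zero, add_zero, neg_zero, mul_neg] at h1 h2
  refine eq_zero_of_form_nonpos ?_ ?_ ?_
  · nlinarith [mul_self_nonneg (v (Sum.inl 0)), mul_self_nonneg (v (Sum.inl 1))]
  · nlinarith [mul_self_nonneg (v (Sum.inl 0)), mul_self_nonneg (v (Sum.inl 1))]
  · simp only [form, Fin.sum_univ_two]
    linarith

theorem form_lightVec (p q : Ein m) :
    form (lightVec p) (lightVec q) = Real.cos (sdist p.1 q.1) - Real.cos (q.2 - p.2) := by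
  rw [cos_sdist, PiLp.inner_apply, Real.cos_sub]
  simp only [form, lightVec, Fin.sum_univ_two, Sum.elim_inl, Sum.elim_inr, Matrix.cons_val_zero,
    Matrix.cons_val_one, RCLike.inner_apply, conj_trivial]
  simp only [mul_comm]
  ring

/-- The determinant thus detects time order for differences less than `π`, which is how an algebraic
sign controls the time orientation. -/
theorem negDet_lightVec (p q : Ein m) :
    negDet (lightVec p) (lightVec q) = Real.sin (q.2 - p.2) := by
  rw [Real.sin_sub]
  simp only [negDet, lightVec, Sum.elim_inl, Matrix.cons_val_zero, Matrix.cons_val_one]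
  ring

/-- Isometries map totally isotropic planes to planes that are graphs over the negative part. -/
theorem negDet_mulVec_ne_zero {B : Mat m} (hB : B ∈ O m) {v w : V m} (hvv : form v v = 0)
    (hvw : form v w = 0) (hww : form w w = 0) (h : negDet v w ≠ 0) :
    negDet (B *ᵥ v) (B *ᵥ w) ≠ 0 := by
  intro h0
  -- A combination of the two images with vanishing negative part is isotropic, hence zero, since
  -- the form is positive on the remaining coordinates.
  have key : ∀ a b : ℝ, a * (B *ᵥ v) (Sum.inl 0) = b * (B *ᵥ w) (Sum.inl 0) →
      a * (B *ᵥ v) (Sum.inl 1) = b * (B *ᵥ w) (Sum.inl 1) → a • v = b • w := by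
    intro a b h1 h2
    rw [← sub_eq_zero]
    apply eq_zero_of_mulVec_eq_zero hB
    apply eq_zero_of_form_nonpos
    · rw [Matrix.mulVec_sub, Matrix.mulVec_smul, Matrix.mulVec_smul]
      exact sub_eq_zero.2 h1
    · rw [Matrix.mulVec_sub, Matrix.mulVec_smul, Matrix.mulVec_smul]
      exact sub_eq_zero.2 h2
    · rw [hB, form_smul_sub_smul, hvv, hvw, hww]
      simp
  have hzero : ∀ a b : ℝ, a • v = b • w → a = 0 := by
    intro a b hab
    by_contra ha
    have h1 : negDet (a • v) (1 • w) = 0 := by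
      rw [hab]
      simp only [negDet, Pi.smul_apply, smul_eq_mul, one_smul]
      ring
    have h2 := negDet_smul_smul a 1 v w
    rw [one_smul] at h2
    rw [one_smul, h2, mul_one] at h1
    exact (mul_ne_zero ha h) h1
  unfold negDet at h0
  -- If the determinant vanishes, each negative coordinate of the images supplies such a
  -- combination. Independence of `v` and `w` then kills the negative part of the image of `w`,
  -- hence `w` itself.
  have e0 := hzero _ _ (key ((B *ᵥ w) (Sum.inl 0)) ((B *ᵥ v) (Sum.inl 0)) (by ring) (by linarith))
  have e1 := hzero _ _ (key ((B *ᵥ w) (Sum.inl 1)) ((B *ᵥ v) (Sum.inl 1)) (by linarith) (by ring))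
  have hw := key 0 1 (by rw [e0]; ring) (by rw [e1]; ring)
  rw [zero_smul, one_smul] at hw
  apply h
  rw [← hw]
  simp [negDet]

/-- The projection of `ℝ^{2,m+1}` to `ℝ^{2,m}`. -/
def dropLast (v : V (m + 1)) : V m :=
  Sum.elim (fun a => v (Sum.inl a)) (fun j => v (Sum.inr j.castSucc))

/-- The decomposition of the coordinates of `ℝ^{2,m+1}` that is used to define `stab`. -/
def stabEquiv (m : ℕ) : (Fin 2 ⊕ Fin m) ⊕ Fin 1 ≃ Fin 2 ⊕ Fin (m + 1) :=
  (Equiv.sumAssoc (Fin 2) (Fin m) (Fin 1)).trans (Equiv.sumCongr (Equiv.refl _) finSumFinEquiv)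

theorem stab_mulVec (A : Mat m) (v : V (m + 1)) (i : (Fin 2 ⊕ Fin m) ⊕ Fin 1) :
    (stab A *ᵥ v) (stabEquiv m i) =
      Sum.elim (A *ᵥ dropLast v) (fun _ => v (Sum.inr (Fin.last m))) i := by
  have h : stab A *ᵥ v = (Matrix.fromBlocks A 0 0 1 *ᵥ (v ∘ stabEquiv m)) ∘ (stabEquiv m).symm :=
    Matrix.submatrix_mulVec_equiv (Matrix.fromBlocks A 0 0 1) v (stabEquiv m).symm (stabEquiv m).symm
  have hd : (v ∘ stabEquiv m) ∘ Sum.inl = dropLast v := by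
    ext (a | j) <;> rfl
  rw [h, Function.comp_apply, Equiv.symm_apply_apply, Matrix.fromBlocks_mulVec, hd]
  rcases i with i | i
  · simp
  · obtain rfl : i = 0 := Subsingleton.elim _ _
    simp only [Matrix.zero_mulVec, zero_add, Matrix.one_mulVec, Sum.elim_inr]
    rfl

theorem stab_mulVec_inl (A : Mat m) (v : V (m + 1)) (a : Fin 2) :
    (stab A *ᵥ v) (Sum.inl a) = (A *ᵥ dropLast v) (Sum.inl a) :=
  stab_mulVec A v (Sum.inl (Sum.inl a))

theorem stab_mulVec_castSucc (A : Mat m) (v : V (m + 1)) (j : Fin m) :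
    (stab A *ᵥ v) (Sum.inr j.castSucc) = (A *ᵥ dropLast v) (Sum.inr j) :=
  stab_mulVec A v (Sum.inl (Sum.inr j))

theorem stab_mulVec_last (A : Mat m) (v : V (m + 1)) :
    (stab A *ᵥ v) (Sum.inr (Fin.last m)) = v (Sum.inr (Fin.last m)) :=
  stab_mulVec A v (Sum.inr 0)

theorem form_eq_dropLast (v w : V (m + 1)) : form v w =
    form (dropLast v) (dropLast w) + v (Sum.inr (Fin.last m)) * w (Sum.inr (Fin.last m)) := by
  simp only [form, dropLast, Fin.sum_univ_castSucc (n := m), Sum.elim_inl, Sum.elim_inr]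
  ring

theorem stab_mem_O {A : Mat m} (hA : A ∈ O m) : stab A ∈ O (m + 1) := by
  intro v w
  have h : ∀ v : V (m + 1), dropLast (stab A *ᵥ v) = A *ᵥ dropLast v := by
    intro v
    ext (a | j)
    · exact stab_mulVec_inl A v a
    · exact stab_mulVec_castSucc A v j
  rw [form_eq_dropLast, h, h, hA, stab_mulVec_last, stab_mulVec_last, ← form_eq_dropLast]

theorem one_mem_O : (1 : Mat m) ∈ O m := fun x y => by rw [Matrix.one_mulVec, Matrix.one_mulVec]

/-- On a totally isotropic pair the determinant never vanishes under isometries, and it depends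
continuously on the matrix. On the connected set `O₀ m`, which contains the identity, its sign
cannot change. -/
theorem negDet_stab_pos {A : Mat m} (hA : A ∈ O₀ m) {v w : V (m + 1)} (hvv : form v v = 0)
    (hvw : form v w = 0) (hww : form w w = 0) (h : 0 < negDet v w) :
    0 < negDet (stab A *ᵥ v) (stab A *ᵥ w) := by
  have hcont : Continuous fun B : Mat m => negDet (stab B *ᵥ v) (stab B *ᵥ w) := by
    simp only [negDet, stab_mulVec_inl]
    fun_prop
  by_contra! hneg
  obtain ⟨B, hB, hB0⟩ := isPreconnected_connectedComponentIn.intermediate_value hA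
    (mem_connectedComponentIn one_mem_O) hcont.continuousOn
    (⟨hneg, by rw [stab_one, Matrix.one_mulVec, Matrix.one_mulVec]; exact h.le⟩ :
      (0 : ℝ) ∈ Icc _ _)
  exact negDet_mulVec_ne_zero (stab_mem_O (connectedComponentIn_subset _ _ hB)) hvv hvw hww h.ne' hB0

end LinearAlgebra

/-! ### Lifts of isometries preserve the causal order. -/

section ConformalMaps

variable {n : ℕ}

/-- Removes the ambiguity modulo `2π`: by continuity from `0`, the function cannot cross a non-zero
root of the sine. -/
theorem mem_Ioo_of_sin_pos {h : ℝ → ℝ} (hc : ContinuousOn h (Icc 0 1)) (h0 : h 0 = 0)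
    (hpos : ∀ τ ∈ Ioc (0 : ℝ) 1, 0 < Real.sin (h τ)) : h 1 ∈ Ioo 0 Real.pi := by
  have h1 := hpos 1 ⟨zero_lt_one, le_rfl⟩
  have hroot : ∀ y, y ≠ 0 → Real.sin y = 0 → y ∉ h '' Icc 0 1 := by
    rintro y hy hs ⟨τ, hτ, rfl⟩
    have hτ0 : τ ≠ 0 := fun h' => hy (h' ▸ h0)
    exact (hpos τ ⟨lt_of_le_of_ne hτ.1 hτ0.symm, hτ.2⟩).ne' hs
  constructor
  · by_contra! hle
    by_cases hp : -Real.pi < h 1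
    · linarith [Real.sin_nonpos_of_nonpos_of_neg_pi_le hle hp.le]
    · refine hroot (-Real.pi) (by linarith [Real.pi_pos]) (by simp)
        (intermediate_value_Icc' zero_le_one hc ⟨by linarith, ?_⟩)
      rw [h0]
      linarith [Real.pi_pos]
  · by_contra! hle
    refine hroot Real.pi Real.pi_pos.ne' Real.sin_pi
      (intermediate_value_Icc zero_le_one hc ⟨?_, hle⟩)
    rw [h0]
    exact Real.pi_pos.le

/-- `f` lifts the action on the Einstein universe of the matrix `B`. -/
def IsLift (B : Mat n) (f : Ein n → Ein n) : Prop :=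
  ∀ p, ∃ r : ℝ, 0 < r ∧ lightVec (f p) = r • (B *ᵥ lightVec p)

variable {A : Mat n} {f : Ein (n + 1) → Ein (n + 1)}

theorem IsLift.form_eq_zero (hA : A ∈ O₀ n) (hf : IsLift (stab A) f) {p q : Ein (n + 1)}
    (h : form (lightVec p) (lightVec q) = 0) : form (lightVec (f p)) (lightVec (f q)) = 0 := by
  obtain ⟨r, -, hr⟩ := hf p
  obtain ⟨s, -, hs⟩ := hf q
  rw [hr, hs, form_smul_smul, stab_mem_O (connectedComponentIn_subset _ _ hA), h, mul_zero]

theorem form_lightVec_self (p : Ein n) : form (lightVec p) (lightVec p) = 0 := by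
  rw [form_lightVec, sdist_self, sub_self, sub_self]

theorem form_lightVec_of_null {p q : Ein n} (h : sdist p.1 q.1 = q.2 - p.2) :
    form (lightVec p) (lightVec q) = 0 := by
  rw [form_lightVec, h, sub_self]

theorem IsLift.sin_pos (hA : A ∈ O₀ n) (hf : IsLift (stab A) f) {p q : Ein (n + 1)}
    (h : sdist p.1 q.1 = q.2 - p.2) (h0 : 0 < q.2 - p.2) (hpi : q.2 - p.2 < Real.pi) :
    0 < Real.sin ((f q).2 - (f p).2) := by
  obtain ⟨r, hr0, hr⟩ := hf p
  obtain ⟨s, hs0, hs⟩ := hf q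
  rw [← negDet_lightVec, hr, hs, negDet_smul_smul]
  refine mul_pos (mul_pos hr0 hs0) (negDet_stab_pos hA (form_lightVec_self p)
    (form_lightVec_of_null h) (form_lightVec_self q) ?_)
  rw [negDet_lightVec]
  exact Real.sin_pos_of_pos_of_lt_pi h0 hpi

/-- Lifts of elements of the identity component preserve future null geodesics. -/
theorem IsLift.null (hn : 2 ≤ n) (hA : A ∈ O₀ n) (hf : IsLift (stab A) f) (hc : Continuous f)
    {p q : Ein (n + 1)} (h : sdist p.1 q.1 = q.2 - p.2) (hpi : q.2 - p.2 < Real.pi) :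
    sdist (f p).1 (f q).1 = (f q).2 - (f p).2 := by
  rcases (h ▸ sdist_nonneg p.1 q.1 : 0 ≤ q.2 - p.2).eq_or_lt with h0 | h0
  · rw [ein_eq_of_sdist_le h.le (by linarith)]
    simp [sdist_self]
  obtain ⟨e, he, hxe, hy⟩ := exists_greatCircle (by omega) p.1 q.1
  set θ := sdist p.1 q.1 with hθ
  let c : ℝ → Ein (n + 1) := fun τ => (greatCircle p.1 he hxe (τ * θ), p.2 + τ * θ)
  have hcc : Continuous c := by
    have h1 : Continuous fun τ : ℝ => τ * θ := by fun_prop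
    exact ((continuous_greatCircle p.1 he hxe).comp h1).prodMk (h1.const_add p.2)
  have hc0 : c 0 = p := by
    simp [c, greatCircle_zero]
  have hc1 : c 1 = q := by
    simp only [c, one_mul, hy]
    exact Prod.ext rfl (by simp only; linarith)
  -- Along the null geodesic the time difference of the images has positive sine, hence stays in
  -- `(0, π)`. Isotropy equates its cosine with that of the distance, and the cosine is injective
  -- there.
  have hmem := mem_Ioo_of_sin_pos (h := fun τ => (f (c τ)).2 - (f p).2)
    (((continuous_snd.comp (hc.comp hcc)).sub continuous_const).continuousOn)
    (by simp [hc0]) (fun τ hτ => by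
      have hτθ : 0 < τ * θ := mul_pos hτ.1 (by linarith)
      have hτθ' : τ * θ ≤ θ := by nlinarith [hτ.2]
      have hd : (c τ).2 - p.2 = τ * θ := by simp [c]
      refine hf.sin_pos hA ?_ (by rw [hd]; exact hτθ) (by rw [hd]; linarith)
      rw [hd]
      have h2 := sdist_greatCircle p.1 he hxe (a := 0) (b := τ * θ)
        (by rw [zero_sub, abs_neg, abs_of_pos hτθ]; linarith)
      rwa [greatCircle_zero, zero_sub, abs_neg, abs_of_pos hτθ] at h2)
  simp only [hc1] at hmem
  have h3 := hf.form_eq_zero hA (form_lightVec_of_null h)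
  rw [form_lightVec, sub_eq_zero] at h3
  exact Real.injOn_cos ⟨sdist_nonneg _ _, sdist_le_pi _ _⟩ ⟨hmem.1.le, hmem.2.le⟩ h3

/-- Cutting at the midpoint covers antipodal ends, which `IsLift.null` excludes; only causality, not
nullity, survives the concatenation. -/
theorem IsLift.causal_of_sdist_eq (hn : 2 ≤ n) (hA : A ∈ O₀ n) (hf : IsLift (stab A) f)
    (hc : Continuous f) {p q : Ein (n + 1)} (h : sdist p.1 q.1 = q.2 - p.2) :
    sdist (f p).1 (f q).1 ≤ (f q).2 - (f p).2 := by
  obtain ⟨e, he, hxe, hy⟩ := exists_greatCircle (by omega) p.1 q.1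
  have hθ := sdist_nonneg p.1 q.1
  have hθp := sdist_le_pi p.1 q.1
  have hp := Real.pi_pos
  set θ := sdist p.1 q.1
  have h1 := sdist_greatCircle p.1 he hxe (a := 0) (b := θ / 2)
    (by rw [zero_sub, abs_neg, abs_of_nonneg (by linarith)]; linarith)
  have h2 := sdist_greatCircle p.1 he hxe (a := θ / 2) (b := θ)
    (by rw [abs_sub_comm, abs_of_nonneg (by linarith)]; linarith)
  rw [greatCircle_zero, zero_sub, abs_neg, abs_of_nonneg (by linarith)] at h1
  rw [hy, abs_sub_comm, abs_of_nonneg (by linarith)] at h2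
  have h3 := hf.null hn hA hc (p := p) (q := (greatCircle p.1 he hxe (θ / 2), p.2 + θ / 2))
    (by simp only; linarith) (by simp only; linarith)
  have h4 := hf.null hn hA hc (p := (greatCircle p.1 he hxe (θ / 2), p.2 + θ / 2)) (q := q)
    (by simp only; linarith) (by simp only; linarith)
  exact sdist_le_trans h3.le h4.le

/-- A short vertical segment has the same ends as a null geodesic going out and another coming back.
A long one is cut into short pieces. -/
theorem IsLift.causal_vertical (hn : 2 ≤ n) (hA : A ∈ O₀ n) (hf : IsLift (stab A) f)
    (hc : Continuous f) (x : Sph (n + 1)) (t : ℝ) {L : ℝ} (hL : 0 ≤ L) :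
    sdist (f (x, t)).1 (f (x, t + L)).1 ≤ (f (x, t + L)).2 - (f (x, t)).2 := by
  have short : ∀ (s δ : ℝ), 0 ≤ δ → δ ≤ 1 →
      sdist (f (x, s)).1 (f (x, s + δ)).1 ≤ (f (x, s + δ)).2 - (f (x, s)).2 := by
    intro s δ h0 h1
    obtain ⟨e, he, hxe⟩ := exists_orthogonal_unit (by omega) x
    have hp := Real.pi_gt_three
    have h2 := sdist_greatCircle x he hxe (a := 0) (b := δ / 2)
      (by rw [zero_sub, abs_neg, abs_of_nonneg (by linarith)]; linarith)
    rw [greatCircle_zero, zero_sub, abs_neg, abs_of_nonneg (by linarith)] at h2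
    have h3 := hf.causal_of_sdist_eq hn hA hc (p := (x, s))
      (q := (greatCircle x he hxe (δ / 2), s + δ / 2)) (by simp only; linarith)
    have h4 := hf.causal_of_sdist_eq hn hA hc (p := (greatCircle x he hxe (δ / 2), s + δ / 2))
      (q := (x, s + δ)) (by simp only; rw [sdist_comm]; linarith)
    exact sdist_le_trans h3 h4
  obtain ⟨N, hN⟩ := exists_nat_ge L
  have hN' : (0 : ℝ) < N + 1 := by positivity
  have key : ∀ m : ℕ, sdist (f (x, t)).1 (f (x, t + m * (L / (N + 1)))).1 ≤
      (f (x, t + m * (L / (N + 1)))).2 - (f (x, t)).2 := by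
    intro m
    induction m with
    | zero => simp [sdist_self]
    | succ m ih =>
      have h := short (t + m * (L / (N + 1))) (L / (N + 1)) (by positivity)
        ((div_le_one hN').2 (by linarith))
      have e : t + ((m + 1 : ℕ) : ℝ) * (L / (N + 1)) = t + m * (L / (N + 1)) + L / (N + 1) := by
        push_cast; ring
      rw [e]
      exact sdist_le_trans ih h
  have h := key (N + 1)
  have e : ((N + 1 : ℕ) : ℝ) * (L / (N + 1)) = L := by
    push_cast; field_simp
  rwa [e] at h

/-- Lifts of elements of the identity component preserve the causal relation. -/
theorem IsLift.causalLE (hn : 2 ≤ n) (hA : A ∈ O₀ n) (hf : IsLift (stab A) f)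
    (hc : Continuous f) {p q : Ein (n + 1)} (h : CausalLE p q) : CausalLE (f p) (f q) := by
  rw [causalLE_iff (by omega)] at h ⊢
  -- From `p` to `q` one can go along a null geodesic to the fibre of `q.1`, then vertically for the
  -- remaining time.
  have h1 := hf.causal_of_sdist_eq hn hA hc (p := p) (q := (q.1, p.2 + sdist p.1 q.1))
    (by simp only; ring)
  have h2 := hf.causal_vertical hn hA hc q.1 (p.2 + sdist p.1 q.1)
    (L := q.2 - p.2 - sdist p.1 q.1) (by linarith)
  have e : p.2 + sdist p.1 q.1 + (q.2 - p.2 - sdist p.1 q.1) = q.2 := by ring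
  rw [e] at h2
  exact sdist_le_trans h1 h2

/-- `stab A` fixes the last coordinate, so a lift only rescales it by a positive factor; hence both
hemispheres and the equator are preserved. -/
theorem IsLift.exists_height_eq (hf : IsLift (stab A) f) (p : Ein (n + 1)) :
    ∃ r : ℝ, 0 < r ∧ height (f p) = r * height p := by
  obtain ⟨r, hr, h⟩ := hf p
  refine ⟨r, hr, ?_⟩
  have h' := congrFun h (Sum.inr (Fin.last n))
  rw [Pi.smul_apply, stab_mulVec_last] at h'
  exact h'

theorem IsLift.mem_adsCopy_iff (hf : IsLift (stab A) f) (i : Fin 2) (p : Ein (n + 1)) :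
    f p ∈ adsCopy n i ↔ p ∈ adsCopy n i := by
  obtain ⟨r, hr, h⟩ := hf.exists_height_eq p
  change 0 < (-1 : ℝ) ^ (i : ℕ) * height (f p) ↔ 0 < (-1 : ℝ) ^ (i : ℕ) * height p
  rw [h, mul_left_comm, mul_pos_iff_of_pos_left hr]

theorem mem_range_einIncl_iff {p : Ein (n + 1)} : p ∈ range (einIncl (k := n)) ↔ height p = 0 := by
  constructor
  · rintro ⟨q, rfl⟩
    exact equator_last q.1
  · intro h
    have hp := norm_sph p.1
    rw [EuclideanSpace.norm_eq, Fin.sum_univ_castSucc] at hp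
    have h' : (p.1 : EuclideanSpace ℝ (Fin (n + 1))) (Fin.last n) = 0 := h
    rw [h', norm_zero, zero_pow two_ne_zero, add_zero] at hp
    refine ⟨(⟨WithLp.toLp 2 fun j => (p.1 : EuclideanSpace ℝ (Fin (n + 1))) j.castSucc, ?_⟩, p.2),
      Prod.ext (Subtype.ext ?_) rfl⟩
    · rw [mem_sphere_zero_iff_norm, EuclideanSpace.norm_eq]
      exact hp
    · ext j
      refine Fin.lastCases ?_ (fun j => ?_) j
      · simp only [einIncl]
        rw [equator_last, h']
      · simp only [einIncl]
        rw [equator_castSucc]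

theorem IsLift.mem_range_einIncl_iff (hf : IsLift (stab A) f) (p : Ein (n + 1)) :
    f p ∈ range (einIncl (k := n)) ↔ p ∈ range (einIncl (k := n)) := by
  obtain ⟨r, hr, h⟩ := hf.exists_height_eq p
  rw [AdSBlackHole.mem_range_einIncl_iff, AdSBlackHole.mem_range_einIncl_iff, h, mul_eq_zero,
    or_iff_right hr.ne']

end ConformalMaps

/-! ### Closedness of the limit set. -/

section LimitSet

variable {n : ℕ}

theorem continuous_form : Continuous fun p : V n × V n => form p.1 p.2 := by
  unfold form
  fun_prop

theorem isClosed_O : IsClosed (O n) := by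
  simp only [O, ofPred_forall]
  refine isClosed_iInter fun x => isClosed_iInter fun y => isClosed_eq ?_ continuous_const
  have h : Continuous fun A : Mat n => (A *ᵥ x, A *ᵥ y) := by fun_prop
  exact continuous_form.comp h

theorem isClosed_O₀ : IsClosed (O₀ n) := by
  refine isClosed_of_closure_subset ?_
  refine IsPreconnected.subset_connectedComponentIn isPreconnected_connectedComponentIn.closure
    (subset_closure (mem_connectedComponentIn one_mem_O)) ?_
  exact closure_minimal (connectedComponentIn_subset _ _) isClosed_O

/-- The columns are Euclidean unit vectors, so all entries lie in `[-1, 1]`. -/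
theorem isCompact_K : IsCompact (K n) := by
  have hbox : IsCompact {A : Mat n | ∀ i j, A i j ∈ Icc (-1 : ℝ) 1} := by
    have h := isCompact_univ_pi (X := fun _ : Fin 2 ⊕ Fin n => Fin 2 ⊕ Fin n → ℝ) fun _ =>
      isCompact_univ_pi (X := fun _ : Fin 2 ⊕ Fin n => ℝ) fun _ => isCompact_Icc (a := (-1 : ℝ)) (b := 1)
    have he : {A : Mat n | ∀ i j, A i j ∈ Icc (-1 : ℝ) 1} = univ.pi fun _ => univ.pi fun _ =>
        Icc (-1 : ℝ) 1 := by
      ext A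
      exact ⟨fun h i _ j _ => h i j, fun h i j => h i trivial j trivial⟩
    rw [he]
    exact h
  refine hbox.of_isClosed_subset ?_ ?_
  · have h : Continuous fun A : Mat n => Aᵀ * A := by fun_prop
    exact isClosed_O₀.inter (isClosed_eq h continuous_const)
  · rintro A ⟨-, hA⟩ i j
    have h := congrFun (congrFun hA j) j
    rw [Matrix.mul_apply, Matrix.one_apply_eq] at h
    have h1 : A i j * A i j ≤ 1 := by
      rw [← h]
      exact Finset.single_le_sum (f := fun i => Aᵀ j i * A i j)
        (fun i _ => mul_self_nonneg (A i j)) (Finset.mem_univ i)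
    rw [mem_Icc, ← abs_le, ← sq_le_one_iff_abs_le_one, sq]
    exact h1

theorem inv_eq_transpose {A : Mat n} (hA : A ∈ K n) : A⁻¹ = Aᵀ := Matrix.inv_eq_left_inv hA.2

theorem eFirst_ne_zero (n : ℕ) : eFirst n ≠ 0 := fun h => by
  simpa [eFirst] using congrFun h (Sum.inl 0)

theorem eLast_ne_zero (n : ℕ) : eLast n ≠ 0 := fun h => by
  simpa [eLast] using congrFun h (Sum.inl 0)

theorem mulVec_ne_zero_of_mem_K {A : Mat n} (hA : A ∈ K n) {v : V n} (hv : v ≠ 0) :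
    A *ᵥ v ≠ 0 := fun h => hv (eq_zero_of_mulVec_eq_zero (connectedComponentIn_subset _ _ hA.1) h)

theorem inv_mulVec_ne_zero_of_mem_K {A : Mat n} (hA : A ∈ K n) {v : V n} (hv : v ≠ 0) :
    A⁻¹ *ᵥ v ≠ 0 := fun h => hv (by
  rw [inv_eq_transpose hA] at h
  have h' := congrArg (fun w => A *ᵥ w) h
  simpa only [Matrix.mulVec_mulVec, mul_eq_one_comm.1 hA.2, Matrix.one_mulVec,
    Matrix.mulVec_zero] using h')

/-- Collinearity with `v` is rewritten as `(v ⬝ᵥ v) • u = (u ⬝ᵥ v) • v`, which passes to the limit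
without control of the coefficients. -/
theorem mem_span_singleton_of_tendsto {u v : ℕ → V n} {u₀ v₀ : V n} (hu : Tendsto u atTop (𝓝 u₀))
    (hv : Tendsto v atTop (𝓝 v₀)) (hv₀ : v₀ ≠ 0) (h : ∀ m, u m ∈ Submodule.span ℝ {v m}) :
    u₀ ∈ Submodule.span ℝ {v₀} := by
  have hdot : Continuous fun p : V n × V n => p.1 ⬝ᵥ p.2 := by fun_prop
  have hv₀' : v₀ ⬝ᵥ v₀ ≠ 0 := fun h => hv₀ (dotProduct_self_eq_zero.1 h)
  have h1 : ∀ m, (v m ⬝ᵥ v m) • u m = (u m ⬝ᵥ v m) • v m := by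
    intro m
    obtain ⟨c, hc⟩ := Submodule.mem_span_singleton.1 (h m)
    rw [← hc, smul_dotProduct, smul_smul, smul_eq_mul, mul_comm]
  have t1 := ((hdot.tendsto (v₀, v₀)).comp (hv.prodMk_nhds hv)).smul hu
  have t2 := ((hdot.tendsto (u₀, v₀)).comp (hu.prodMk_nhds hv)).smul hv
  have h2 : (v₀ ⬝ᵥ v₀) • u₀ = (u₀ ⬝ᵥ v₀) • v₀ :=
    tendsto_nhds_unique t1 (t2.congr fun m => (h1 m).symm)
  refine Submodule.mem_span_singleton.2 ⟨(v₀ ⬝ᵥ v₀)⁻¹ * (u₀ ⬝ᵥ v₀), ?_⟩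
  rw [mul_smul, ← h2, smul_smul, inv_mul_cancel₀ hv₀', one_smul]

/-- Picks one term of the sequence with a large gap and Cartan factors close to their limits. Two
Cartan decompositions are kept because the one witnessing divergence need not be the one defining
the attracting and repelling points. -/
theorem exists_approx_of_isAttractingRepelling {g : ℕ → Mat n} {p q : ℙ ℝ (V n)}
    (hg : IsP1Divergent g) (h : IsAttractingRepelling g p q) (N : ℝ) {ε : ℝ} (hε : 0 < ε) :
    ∃ (j : ℕ) (k l kInf lInf : Mat n),
      (∃ lam mu, IsCartanDecomposition (g j) k l lam mu) ∧
      (∃ k' l' lam mu, IsCartanDecomposition (g j) k' l' lam mu ∧ N ≤ lam - |mu|) ∧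
      kInf ∈ K n ∧ lInf ∈ K n ∧
      (∀ a b, |kInf a b - k a b| < ε) ∧ (∀ a b, |lInf a b - l a b| < ε) ∧
      p.submodule = Submodule.span ℝ {kInf *ᵥ eFirst n} ∧
      q.submodule = Submodule.span ℝ {lInf⁻¹ *ᵥ eLast n} := by
  obtain ⟨φ, k, l, lam, mu, kInf, lInf, hφ, hc, hk, hl, hp, hq⟩ := h
  obtain ⟨k', l', lam', mu', hc', hgap⟩ := hg
  have close : ∀ {s : ℕ → Mat n} {s₀ : Mat n}, Tendsto s atTop (𝓝 s₀) →
      ∀ᶠ i in atTop, ∀ a b, |s₀ a b - s i a b| < ε := by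
    intro s s₀ hs
    refine eventually_all.2 fun a => eventually_all.2 fun b => ?_
    have h1 := tendsto_pi_nhds.1 (tendsto_pi_nhds.1 hs a) b
    filter_upwards [Metric.tendsto_nhds.1 h1 ε hε] with i hi
    rwa [Real.dist_eq, abs_sub_comm] at hi
  obtain ⟨i, h1, h2, h3⟩ := ((close hk).and ((close hl).and
    (hφ.tendsto_atTop.eventually (hgap.eventually_ge_atTop N)))).exists
  exact ⟨φ i, k i, l i, kInf, lInf, ⟨_, _, hc i⟩, ⟨_, _, _, _, hc' (φ i), h3⟩,
    isCompact_K.isClosed.mem_of_tendsto hk (Eventually.of_forall fun i => (hc i).1),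
    isCompact_K.isClosed.mem_of_tendsto hl (Eventually.of_forall fun i => (hc i).2.1),
    h1, h2, hp, hq⟩

theorem tendsto_of_entries_close {s s' : ℕ → Mat n} {s₀ : Mat n} {ε : ℕ → ℝ}
    (hε : Tendsto ε atTop (𝓝 0)) (hs : Tendsto s atTop (𝓝 s₀))
    (h : ∀ i a b, |s' i a b - s i a b| < ε i) : Tendsto s' atTop (𝓝 s₀) := by
  refine tendsto_pi_nhds.2 fun a => tendsto_pi_nhds.2 fun b => ?_
  have h1 := tendsto_pi_nhds.1 (tendsto_pi_nhds.1 hs a) b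
  have h2 : Tendsto (fun i => s' i a b - s i a b) atTop (𝓝 0) :=
    squeeze_zero_norm (fun i => (h i a b).le) hε
  simpa using h2.add h1

/-- Diagonal extraction: limits of attracting and repelling points are again attracting and
repelling points. -/
theorem exists_diagonal_sequence {H : Set (Mat n)} {g : ℕ → ℕ → Mat n} {p q : ℕ → ℙ ℝ (V n)}
    (hH : ∀ m i, g m i ∈ H) (hg : ∀ m, IsP1Divergent (g m))
    (h : ∀ m, IsAttractingRepelling (g m) (p m) (q m)) :
    ∃ (ψ : ℕ → ℕ) (k l : ℕ → Mat n) (k₀ l₀ : Mat n) (g' : ℕ → Mat n), StrictMono ψ ∧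
      Tendsto k atTop (𝓝 k₀) ∧ Tendsto l atTop (𝓝 l₀) ∧ k₀ ∈ K n ∧ l₀ ∈ K n ∧
      (∀ m, l m ∈ K n) ∧
      (∀ m, (p (ψ m)).submodule = Submodule.span ℝ {k m *ᵥ eFirst n}) ∧
      (∀ m, (q (ψ m)).submodule = Submodule.span ℝ {(l m)⁻¹ *ᵥ eLast n}) ∧
      (∀ m, g' m ∈ H) ∧ IsP1Divergent g' ∧
      ∀ p₀ q₀ : ℙ ℝ (V n), p₀.submodule = Submodule.span ℝ {k₀ *ᵥ eFirst n} →
        q₀.submodule = Submodule.span ℝ {l₀⁻¹ *ᵥ eLast n} → IsAttractingRepelling g' p₀ q₀ := by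
  -- From the `m`-th sequence take a term with gap at least `m` and error less than `1 / (m + 1)`.
  -- The diagonal sequence then diverges, and its factors have the same limits as the limiting
  -- factors `kInf` and `lInf`.
  choose j k l kInf lInf hc hc' hk hl hkε hlε hp hq using fun m : ℕ =>
    exists_approx_of_isAttractingRepelling (hg m) (h m) m
      (show (0 : ℝ) < 1 / ((m : ℝ) + 1) by positivity)
  choose lam mu hc using hc
  choose k' l' lam' mu' hc' hgap using hc'
  have : FirstCountableTopology (Mat n) :=
    inferInstanceAs (FirstCountableTopology (Fin 2 ⊕ Fin n → Fin 2 ⊕ Fin n → ℝ))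
  obtain ⟨⟨k₀, l₀⟩, ⟨hk₀, hl₀⟩, ψ, hψ, hlim⟩ := (isCompact_K.prod isCompact_K).tendsto_subseq
    (x := fun m => (k m, l m)) fun m => ⟨(hc m).1, (hc m).2.1⟩
  have hkl : Tendsto (fun m => k (ψ m)) atTop (𝓝 k₀) := (continuous_fst.tendsto _).comp hlim
  have hll : Tendsto (fun m => l (ψ m)) atTop (𝓝 l₀) := (continuous_snd.tendsto _).comp hlim
  have hε : Tendsto (fun m => 1 / ((ψ m : ℝ) + 1)) atTop (𝓝 0) :=
    tendsto_one_div_add_atTop_nhds_zero_nat.comp hψ.tendsto_atTop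
  refine ⟨ψ, fun m => kInf (ψ m), fun m => lInf (ψ m), k₀, l₀, fun m => g m (j m), hψ,
    tendsto_of_entries_close hε hkl fun m => hkε (ψ m),
    tendsto_of_entries_close hε hll fun m => hlε (ψ m), hk₀, hl₀, fun m => hl _,
    fun m => hp _, fun m => hq _, fun m => hH _ _, ⟨k', l', lam', mu', hc',
      tendsto_atTop_mono hgap tendsto_natCast_atTop_atTop⟩, fun p₀ q₀ hp₀ hq₀ => ?_⟩
  exact ⟨ψ, _, _, _, _, k₀, l₀, hψ, fun i => hc (ψ i), hkl, hll, hp₀, hq₀⟩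

theorem continuous_lightVec : Continuous (lightVec (k := n)) := by
  refine continuous_pi fun i => ?_
  rcases i with a | j
  · fin_cases a
    · exact Real.continuous_cos.comp continuous_snd
    · exact Real.continuous_sin.comp continuous_snd
  · exact (PiLp.continuous_apply 2 _ j).comp (continuous_subtype_val.comp continuous_fst)

theorem submodule_einProj (p : Ein n) :
    (einProj p).submodule = Submodule.span ℝ {lightVec p} := Projectivization.submodule_mk _ _

theorem submodule_einProj_eq_of_mem_span {p : Ein n} {v : V n}
    (h : lightVec p ∈ Submodule.span ℝ {v}) :
    (einProj p).submodule = Submodule.span ℝ {v} := by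
  rw [submodule_einProj]
  obtain ⟨c, hc⟩ := Submodule.mem_span_singleton.1 h
  have hc0 : c ≠ 0 := by
    rintro rfl
    exact lightVec_ne_zero p (by rw [← hc, zero_smul])
  rw [← hc, Submodule.span_singleton_smul_eq (IsUnit.mk0 c hc0)]

theorem lightVec_mem_of_submodule_eq {p : Ein n} {v : V n}
    (h : (einProj p).submodule = Submodule.span ℝ {v}) : lightVec p ∈ Submodule.span ℝ {v} := by
  rw [← h, submodule_einProj]
  exact Submodule.mem_span_singleton_self _

/-- Attracting and repelling points are treated separately, so that one role persists along the
sequence. The diagonal sequence realizes the limit point in that role, its partner being the line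
defined by the other limiting Cartan factor. -/
theorem isClosed_preimage_limitSet (H : Set (Mat n)) :
    IsClosed {p : Ein n | einProj p ∈ limitSet H} := by
  have hunion : {p : Ein n | einProj p ∈ limitSet H} =
      {p | ∃ g : ℕ → Mat n, (∀ i, g i ∈ H) ∧ IsP1Divergent g ∧
        ∃ q, IsAttractingRepelling g (einProj p) q} ∪
      {p | ∃ g : ℕ → Mat n, (∀ i, g i ∈ H) ∧ IsP1Divergent g ∧
        ∃ q, IsAttractingRepelling g q (einProj p)} := by
    ext p
    constructor
    · rintro ⟨g, h1, h2, q, h3 | h3⟩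
      exacts [Or.inl ⟨g, h1, h2, q, h3⟩, Or.inr ⟨g, h1, h2, q, h3⟩]
    · rintro (⟨g, h1, h2, q, h3⟩ | ⟨g, h1, h2, q, h3⟩)
      exacts [⟨g, h1, h2, q, Or.inl h3⟩, ⟨g, h1, h2, q, Or.inr h3⟩]
  rw [hunion]
  refine IsClosed.union (IsSeqClosed.isClosed ?_) (IsSeqClosed.isClosed ?_)
  · intro u p hu hlim
    choose g h1 h2 q h3 using hu
    obtain ⟨ψ, k, l, k₀, l₀, g', hψ, hk, -, hk₀, hl₀, -, hp, -, hH, hdiv, har⟩ :=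
      exists_diagonal_sequence h1 h2 h3
    have hkv : Tendsto (fun m => k m *ᵥ eFirst n) atTop (𝓝 (k₀ *ᵥ eFirst n)) := by
      have h : Continuous fun A : Mat n => A *ᵥ eFirst n := by fun_prop
      exact (h.tendsto _).comp hk
    have hmem := mem_span_singleton_of_tendsto
      ((continuous_lightVec.tendsto p).comp (hlim.comp hψ.tendsto_atTop)) hkv
      (mulVec_ne_zero_of_mem_K hk₀ (eFirst_ne_zero n)) fun m => lightVec_mem_of_submodule_eq (hp m)
    exact ⟨g', hH, hdiv,
      Projectivization.mk ℝ _ (inv_mulVec_ne_zero_of_mem_K hl₀ (eLast_ne_zero n)),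
      har _ _ (submodule_einProj_eq_of_mem_span hmem) (Projectivization.submodule_mk _ _)⟩
  · intro u p hu hlim
    choose g h1 h2 q h3 using hu
    obtain ⟨ψ, k, l, k₀, l₀, g', hψ, -, hl, hk₀, hl₀, hlK, -, hq, hH, hdiv, har⟩ :=
      exists_diagonal_sequence h1 h2 h3
    have hlv : Tendsto (fun m => (l m)⁻¹ *ᵥ eLast n) atTop (𝓝 (l₀⁻¹ *ᵥ eLast n)) := by
      have h : Continuous fun A : Mat n => Aᵀ *ᵥ eLast n := by fun_prop
      simp only [inv_eq_transpose hl₀, inv_eq_transpose (hlK _)]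
      exact (h.tendsto _).comp hl
    have hmem := mem_span_singleton_of_tendsto
      ((continuous_lightVec.tendsto p).comp (hlim.comp hψ.tendsto_atTop)) hlv
      (inv_mulVec_ne_zero_of_mem_K hl₀ (eLast_ne_zero n)) fun m => lightVec_mem_of_submodule_eq (hq m)
    exact ⟨g', hH, hdiv,
      Projectivization.mk ℝ _ (mulVec_ne_zero_of_mem_K hk₀ (eFirst_ne_zero n)),
      har _ _ (Projectivization.submodule_mk _ _) (submodule_einProj_eq_of_mem_span hmem)⟩

end LimitSet

/-! ### Compactness of acausal lifts of closed sets. -/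

section Compactness

variable {n : ℕ} {A : Set (Ein n)}

/-- Two points with the same image in projective space are equal or opposite, up to periods. -/
theorem eq_or_antipodal_of_einProj_eq {p q : Ein n} (h : einProj p = einProj q) :
    p.1 = q.1 ∨ (p.1 = -q.1 ∧ Real.cos (p.2 - q.2) = -1) := by
  obtain ⟨c, hc⟩ := (Projectivization.mk_eq_mk_iff' ℝ _ _ _ _).1 h
  have hx : (p.1 : EuclideanSpace ℝ (Fin n)) = c • (q.1 : EuclideanSpace ℝ (Fin n)) := by
    ext j
    exact (congrFun hc (Sum.inr j)).symm
  have hcos : c * Real.cos q.2 = Real.cos p.2 := congrFun hc (Sum.inl 0)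
  have hsin : c * Real.sin q.2 = Real.sin p.2 := congrFun hc (Sum.inl 1)
  have habs : |c| = 1 := by
    have h1 := norm_sph p.1
    rwa [hx, norm_smul, norm_sph, mul_one, Real.norm_eq_abs] at h1
  rcases eq_or_eq_neg_of_abs_eq habs with rfl | rfl
  · exact Or.inl (Subtype.ext (by rw [hx, one_smul]))
  · refine Or.inr ⟨Subtype.ext (by rw [hx, neg_one_smul]; rfl), ?_⟩
    rw [Real.cos_sub, ← hcos, ← hsin]
    linarith [Real.sin_sq_add_cos_sq q.2]

theorem abs_sub_le_of_mem_closure (hn : 2 ≤ n) (hac : IsAcausal A) {p q : Ein n}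
    (hp : p ∈ closure A) (hq : q ∈ A) : |p.2 - q.2| ≤ sdist p.1 q.1 := by
  have hcl : IsClosed {p : Ein n | |p.2 - q.2| ≤ sdist p.1 q.1} :=
    isClosed_le (continuous_snd.sub continuous_const).abs
      ((continuous_sdist_left q.1).comp continuous_fst)
  refine closure_minimal (fun r hr => ?_) hcl hp
  by_cases hrq : r = q
  · rw [mem_ofPred_eq, hrq, sub_self, abs_zero, sdist_self]
  · exact ((isAcausal_iff hn).1 hac r hr q hq hrq).le

theorem abs_eq_pi_of_cos_eq_neg_one {a : ℝ} (h : Real.cos a = -1) (h' : |a| ≤ Real.pi) :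
    |a| = Real.pi :=
  Real.injOn_cos ⟨abs_nonneg a, h'⟩ ⟨Real.pi_pos.le, le_rfl⟩ (by rw [Real.cos_abs, h, Real.cos_pi])

/-- An acausal lift of a closed subset of the projective Einstein universe is compact. -/
theorem isCompact_of_isClosed_preimage (hn : 2 ≤ n) (hac : IsAcausal A) (hne : A.Nonempty)
    (hcl : IsClosed {p : Ein n | einProj p ∈ einProj '' A}) : IsCompact A := by
  have hclosed : IsClosed A := by
    refine isClosed_of_closure_subset fun p hp => ?_
    obtain ⟨q, hq, hqp⟩ := closure_minimal (fun r hr => mem_image_of_mem einProj hr) hcl hp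
    have hpq := abs_sub_le_of_mem_closure hn hac hp hq
    rcases eq_or_antipodal_of_einProj_eq hqp.symm with h | ⟨h, hcos⟩
    · rw [h, sdist_self] at hpq
      have h2 : p = q := Prod.ext h (by linarith [abs_nonpos_iff.1 (le_antisymm hpq (abs_nonneg _)).le])
      exact h2 ▸ hq
    · have hpi := abs_eq_pi_of_cos_eq_neg_one hcos (hpq.trans (sdist_le_pi _ _))
      have hsub : A ⊆ {q} := by
        intro r hr
        by_contra hrq
        have h1 := abs_lt.1 ((isAcausal_iff hn).1 hac r hr q hq hrq)
        have h2 := abs_le.1 (abs_sub_le_of_mem_closure hn hac hp hr)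
        rw [h, sdist_neg_left, sdist_comm] at h2
        rcases abs_eq_abs.1 (hpi.trans (abs_of_pos Real.pi_pos).symm) with h3 | h3 <;> linarith
      have h4 : p = q := closure_minimal hsub isClosed_singleton hp
      exact h4 ▸ hq
  obtain ⟨q, hq⟩ := hne
  -- Acausality bounds the times, since the sphere has diameter at most `π`.
  have hsub : A ⊆ univ ×ˢ Icc (q.2 - Real.pi) (q.2 + Real.pi) := by
    intro p hp
    have h := abs_le.1 ((abs_sub_le_of_mem_closure hn hac (subset_closure hp) hq).trans
      (sdist_le_pi _ _))
    exact ⟨mem_univ _, by linarith, by linarith⟩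
  exact (isCompact_univ.prod isCompact_Icc).of_isClosed_subset hclosed hsub

end Compactness

/-! ### Descent to the quotient spacetime. -/

section Quotient

variable {Γ : Type*} [Group Γ] {n : ℕ} {ρ : Γ →* Mat n} {A : Set (Ein n)}

theorem exists_isLift {f : Ein (n + 1) ≃ₜ Ein (n + 1)} (hf : f ∈ liftGroup ρ A) :
    ∃ γ, IsLift (stab (ρ γ)) f := hf.1

theorem liftGroup_causalLE (hn : 2 ≤ n) (hρ : ∀ γ, ρ γ ∈ O₀ n) {f : Ein (n + 1) ≃ₜ Ein (n + 1)}
    (hf : f ∈ liftGroup ρ A) {p q : Ein (n + 1)} (h : CausalLE p q) : CausalLE (f p) (f q) := by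
  obtain ⟨γ, hγ⟩ := exists_isLift hf
  exact hγ.causalLE hn (hρ γ) f.continuous h

theorem inv_apply_self (f : Ein (n + 1) ≃ₜ Ein (n + 1)) (p : Ein (n + 1)) : f⁻¹ (f p) = p :=
  f.symm_apply_apply p

/-- A set is invariant if it is preserved by the lifts of `ρ(Γ)`. -/
def IsLiftInvariant (ρ : Γ →* Mat n) (A : Set (Ein n)) (X : Set (Ein (n + 1))) : Prop :=
  ∀ f ∈ liftGroup ρ A, ∀ p ∈ X, f p ∈ X

theorem IsLiftInvariant.inter {X Y : Set (Ein (n + 1))} (hX : IsLiftInvariant ρ A X)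
    (hY : IsLiftInvariant ρ A Y) : IsLiftInvariant ρ A (X ∩ Y) :=
  fun f hf p hp => ⟨hX f hf p hp.1, hY f hf p hp.2⟩

theorem IsLiftInvariant.interior {X : Set (Ein (n + 1))} (hX : IsLiftInvariant ρ A X) :
    IsLiftInvariant ρ A (_root_.interior X) := by
  intro f hf p hp
  have h : f '' _root_.interior X ⊆ _root_.interior X := by
    rw [f.image_interior]
    refine interior_mono ?_
    rintro _ ⟨q, hq, rfl⟩
    exact hX f hf q hq
  exact h (mem_image_of_mem _ hp)

theorem isLiftInvariant_invisibleDomain (hn : 2 ≤ n) (hρ : ∀ γ, ρ γ ∈ O₀ n) :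
    IsLiftInvariant ρ A (invisibleDomain (einIncl '' A)) := by
  intro f hf p hp
  have hmem : ∀ a ∈ einIncl '' A, f⁻¹ a ∈ einIncl '' A := by
    intro a ha
    rw [← (inv_mem hf).2]
    exact mem_image_of_mem _ ha
  rintro (⟨a, ha, h⟩ | ⟨a, ha, h⟩)
  · have := liftGroup_causalLE hn hρ (inv_mem hf) h
    rw [inv_apply_self] at this
    exact hp (Or.inl ⟨_, hmem a ha, this⟩)
  · have := liftGroup_causalLE hn hρ (inv_mem hf) h
    rw [inv_apply_self] at this
    exact hp (Or.inr ⟨_, hmem a ha, this⟩)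

theorem isLiftInvariant_adsCopy (i : Fin 2) : IsLiftInvariant ρ A (adsCopy n i) := by
  intro f hf p hp
  obtain ⟨γ, hγ⟩ := exists_isLift hf
  exact (hγ.mem_adsCopy_iff i p).2 hp

theorem isLiftInvariant_range_einIncl : IsLiftInvariant ρ A (range einIncl) := by
  intro f hf p hp
  obtain ⟨γ, hγ⟩ := exists_isLift hf
  exact (hγ.mem_range_einIncl_iff p).2 hp

theorem isLiftInvariant_regularDomain (hn : 2 ≤ n) (hρ : ∀ γ, ρ γ ∈ O₀ n) (i : Fin 2) :
    IsLiftInvariant ρ A (regularDomain i A) :=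
  (isLiftInvariant_adsCopy i).inter (isLiftInvariant_invisibleDomain hn hρ)

theorem isLiftInvariant_boundaryDomain (hn : 2 ≤ n) (hρ : ∀ γ, ρ γ ∈ O₀ n) :
    IsLiftInvariant ρ A (boundaryDomain A) :=
  (isLiftInvariant_invisibleDomain hn hρ).inter isLiftInvariant_range_einIncl

theorem isLiftInvariant_unseeingSet (hn : 2 ≤ n) (hρ : ∀ γ, ρ γ ∈ O₀ n) (i : Fin 2) :
    IsLiftInvariant ρ A (unseeingSet i A) := by
  intro f hf p hp
  refine ⟨isLiftInvariant_regularDomain hn hρ i f hf p hp.1, fun q hq h => ?_⟩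
  have h' := liftGroup_causalLE hn hρ (inv_mem hf) h
  rw [inv_apply_self] at h'
  exact hp.2 _ (isLiftInvariant_boundaryDomain hn hρ _ (inv_mem hf) q hq) h'

/-- The projection of the invisible domain to its quotient. -/
def quotMk (ρ : Γ →* Mat n) (A : Set (Ein n)) : invisibleDomain (einIncl '' A) → M ρ A :=
  Quotient.mk (orbitSetoid ρ A)

theorem quotMk_surjective : Function.Surjective (quotMk ρ A) := Quotient.mk_surjective

theorem quotMk_eq_iff {p q : invisibleDomain (einIncl '' A)} :
    quotMk ρ A p = quotMk ρ A q ↔ ∃ f ∈ liftGroup ρ A, f p.1 = q.1 := Quotient.eq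

theorem continuous_quotMk : Continuous (quotMk ρ A) := continuous_coinduced_rng

/-- Invariant sets are saturated, so subsets of the quotient can be compared through their
preimages. -/
theorem preimage_quotImage {X : Set (Ein (n + 1))} (hX : IsLiftInvariant ρ A X) :
    quotMk ρ A ⁻¹' quotImage ρ A X = Subtype.val ⁻¹' X := by
  ext p
  constructor
  · rintro ⟨q, hq, h⟩
    obtain ⟨f, hf, hfq⟩ := quotMk_eq_iff.1 h
    rw [mem_preimage, ← hfq]
    exact hX f hf _ hq
  · exact fun hp => ⟨p, hp, rfl⟩

/-- The saturation of an open set is a union of its translates by homeomorphisms. Openness is what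
makes interiors and frontiers commute with preimages. -/
theorem isOpenMap_quotMk (hopen : IsOpen (invisibleDomain (einIncl '' A))) :
    IsOpenMap (quotMk ρ A) := by
  intro U hU
  have h : quotMk ρ A ⁻¹' (quotMk ρ A '' U) =
      Subtype.val ⁻¹' ⋃ f ∈ liftGroup ρ A, f '' (Subtype.val '' U) := by
    ext p
    simp only [mem_preimage, mem_image, mem_iUnion, exists_prop]
    constructor
    · rintro ⟨q, hq, h⟩
      obtain ⟨f, hf, hfq⟩ := quotMk_eq_iff.1 h
      exact ⟨f, hf, q.1, ⟨q, hq, rfl⟩, hfq⟩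
    · rintro ⟨f, hf, _, ⟨q, hq, rfl⟩, hfq⟩
      exact ⟨q, hq, quotMk_eq_iff.2 ⟨f, hf, hfq⟩⟩
  change IsOpen (quotMk ρ A ⁻¹' (quotMk ρ A '' U))
  rw [h]
  exact (isOpen_biUnion fun f _ =>
    f.isOpenMap _ (hopen.isOpenMap_subtype_val U hU)).preimage continuous_subtype_val

/-- A point of the regular domain sees the boundary in the quotient if and only if it is in the
past of the boundary part of the invisible domain. -/
theorem seesBoundary_quotMk_iff (hn : 2 ≤ n) (hρ : ∀ γ, ρ γ ∈ O₀ n) {i : Fin 2}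
    {p : invisibleDomain (einIncl '' A)} (hp : p.1 ∈ adsCopy n i) :
    SeesBoundary ρ A (quotMk ρ A p) ↔ ∃ q ∈ boundaryDomain A, CausalLE p.1 q := by
  constructor
  · rintro ⟨c, ⟨N, t, ht0, htN, hc⟩, hc0, hc1⟩
    have hend : ∀ p', quotMk ρ A p' = c (t N) → ∃ q ∈ boundaryDomain A, CausalLE p'.1 q := by
      intro p' hp'
      obtain ⟨p₀, hp₀, h⟩ := hc1
      rw [htN, ← h] at hp'
      obtain ⟨f, hf, hfp⟩ := quotMk_eq_iff.1 hp'.symm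
      exact ⟨p'.1, ⟨p'.2, hfp ▸ isLiftInvariant_range_einIncl f hf _ hp₀⟩, Or.inl rfl⟩
    -- Induction on the number of remaining pieces, starting from the end of the curve. The claim is
    -- for every lift of the break point, because lifts of consecutive pieces match only up to the
    -- group.
    have key : ∀ j ≤ N, ∀ p', quotMk ρ A p' = c (t (N - j)) →
        ∃ q ∈ boundaryDomain A, CausalLE p'.1 q := by
      intro j
      induction j with
      | zero => exact fun _ => hend
      | succ j ih =>
        intro hj p' hp'
        obtain ⟨d, hd, hdc⟩ := hc (N - (j + 1)) (by omega)
        have hs : N - (j + 1) + 1 = N - j := by omega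
        rw [hs] at hd hdc
        obtain ⟨h1, e1⟩ := hdc _ (left_mem_Icc.2 hd.1.le)
        obtain ⟨h2, e2⟩ := hdc _ (right_mem_Icc.2 hd.1.le)
        obtain ⟨q, hq, hle⟩ := ih (by omega) ⟨_, h2⟩ e2.symm
        have hd' : CausalLE (d (t (N - (j + 1)))) (d (t (N - j))) :=
          (causalLE_iff (by omega)).2 (sdist_le_of_causalArc hd)
        obtain ⟨f, hf, hfp⟩ := quotMk_eq_iff.1 (hp'.trans e1).symm
        refine ⟨f q, isLiftInvariant_boundaryDomain hn hρ f hf q hq, ?_⟩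
        rw [← hfp]
        exact liftGroup_causalLE hn hρ hf (hd'.trans (by omega) hle)
    refine key N le_rfl p ?_
    rw [Nat.sub_self, ht0, hc0]
  · rintro ⟨q, hq, hpq⟩
    -- A causal arc needs distinct ends; `p` is off the equator and `q` is on it.
    have hne : p.1 ≠ q := by
      rintro h
      exact height_ne_zero hp (mem_range_einIncl_iff.1 (h ▸ hq.2))
    obtain ⟨d, hd, hd0, hd1, hbetween⟩ :=
      exists_causalArc (by omega) hne ((causalLE_iff (by omega)).1 hpq)
    have hmem : ∀ s ∈ Icc (0 : ℝ) 1, d s ∈ invisibleDomain (einIncl '' A) := fun s hs =>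
      mem_invisibleDomain_of_between (by omega) p.2 hq.1
        ((causalLE_iff (by omega)).2 (hbetween s hs).1)
        ((causalLE_iff (by omega)).2 (hbetween s hs).2)
    classical
    let c : ℝ → M ρ A := fun s => if h : s ∈ Icc (0 : ℝ) 1 then quotMk ρ A ⟨d s, hmem s h⟩
      else quotMk ρ A p
    have hcs : ∀ s (h : s ∈ Icc (0 : ℝ) 1), c s = quotMk ρ A ⟨d s, hmem s h⟩ :=
      fun s h => dif_pos h
    refine ⟨c, ⟨1, fun i => i, by simp, by simp, fun i hi => ?_⟩, ?_, ?_⟩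
    · obtain rfl : i = 0 := by omega
      refine ⟨d, by simpa using hd, fun s hs => ?_⟩
      have hs' : s ∈ Icc (0 : ℝ) 1 := by simpa using hs
      exact ⟨hmem s hs', hcs s hs'⟩
    · rw [hcs 0 (left_mem_Icc.2 zero_le_one)]
      exact congrArg _ (Subtype.ext hd0)
    · rw [hcs 1 (right_mem_Icc.2 zero_le_one)]
      refine ⟨⟨d 1, _⟩, ?_, rfl⟩
      change d 1 ∈ range einIncl
      rw [hd1]
      exact hq.2

theorem preimage_Mi (hn : 2 ≤ n) (hρ : ∀ γ, ρ γ ∈ O₀ n) (i : Fin 2) :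
    quotMk ρ A ⁻¹' Mi ρ A i = Subtype.val ⁻¹' regularDomain i A :=
  preimage_quotImage (isLiftInvariant_regularDomain hn hρ i)

theorem preimage_Mi_diff_pastOfBoundary (hn : 2 ≤ n) (hρ : ∀ γ, ρ γ ∈ O₀ n) (i : Fin 2) :
    quotMk ρ A ⁻¹' (Mi ρ A i \ pastOfBoundary ρ A i) = Subtype.val ⁻¹' unseeingSet i A := by
  ext p
  have h1 : quotMk ρ A p ∈ Mi ρ A i ↔ p.1 ∈ regularDomain i A :=
    Set.ext_iff.1 (preimage_Mi hn hρ i) p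
  simp only [mem_preimage, Set.mem_sdiff, pastOfBoundary, unseeingSet, mem_ofPred_eq, h1, not_and]
  refine and_congr_right fun hp => ?_
  rw [seesBoundary_quotMk_iff hn hρ hp.1]
  push Not
  exact ⟨fun h => h hp, fun h _ => h⟩

/-- Invariance of the regular domain of the upper graph comes from its description as the interior
of the invariant set `unseeingSet i A`; no action on the upper graph itself has to be computed. -/
theorem preimage_Bi (hn : 2 ≤ n) (hρ : ∀ γ, ρ γ ∈ O₀ n) (hA : IsCompact A) (hac : IsAcausal A)
    (hne : A.Nonempty) (i : Fin 2) :
    quotMk ρ A ⁻¹' Bi ρ A i = Subtype.val ⁻¹' regularDomain i (upperGraph A) := by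
  refine preimage_quotImage ?_
  rw [← interior_unseeingSet hn hA hac hne]
  exact (isLiftInvariant_unseeingSet hn hρ i).interior

end Quotient

/-- The limit set has compact acausal lifts. -/
theorem isCompact_of_einProj_image_eq_limitSet {n : ℕ} (hn : 2 ≤ n) {A : Set (Ein n)}
    (hac : IsAcausal A) (hne : A.Nonempty) {H : Set (Mat n)} (h : einProj '' A = limitSet H) :
    IsCompact A := by
  refine isCompact_of_isClosed_preimage hn hac hne ?_
  rw [h]
  exact isClosed_preimage_limitSet H

/-- The black hole of the quotient by a group of isometries of the invisible domain of a compact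
acausal set that is not a topological sphere. -/
theorem blackHole_of_isCompact {n : ℕ} (hn : 2 ≤ n) {Γ : Type*} [Group Γ] {ρ : Γ →* Mat n}
    (hO : ∀ γ, ρ γ ∈ O₀ n) {A : Set (Ein n)} (hA : IsCompact A) (hac : IsAcausal A)
    (hne : A.Nonempty) (hsphere : ¬ Nonempty (A ≃ₜ Sph n)) (i : Fin 2) :
    (conformalBoundary ρ A).Nonempty ∧
    Bi ρ A i ⊆ Mi ρ A i ∧
    (∀ P ∈ Bi ρ A i, ¬ SeesBoundary ρ A P) ∧
    Bi ρ A i = interior (Mi ρ A i \ pastOfBoundary ρ A i) ∧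
    {P | P ∈ Mi ρ A i ∧ ¬ SeesBoundary ρ A P} =
      Bi ρ A i ∪ (frontier (Bi ρ A i) ∩ Mi ρ A i) ∧
    IsPreconnected (Bi ρ A i) ∧
    (A.Nontrivial → (Bi ρ A i).Nonempty) := by
  have hopen : IsOpen (invisibleDomain (einIncl '' A)) :=
    isOpen_invisibleDomain (by omega) (hA.image continuous_einIncl) (hne.image _)
  have hq : IsOpenMap (quotMk ρ A) := isOpenMap_quotMk hopen
  have hv := hopen.isOpenMap_subtype_val
  -- Since the projection is surjective, equalities between subsets of the quotient may be checked
  -- in the invisible domain, and then in `Ein (n + 1)`, where that domain is open.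
  have hinj : Function.Injective (preimage (quotMk ρ A)) := quotMk_surjective.preimage_injective
  have hdiff : {P | P ∈ Mi ρ A i ∧ ¬ SeesBoundary ρ A P} =
      Mi ρ A i \ pastOfBoundary ρ A i := by
    ext P
    simp only [pastOfBoundary, mem_ofPred_eq, Set.mem_sdiff, not_and]
    exact and_congr_right fun h => ⟨fun h' _ => h', fun h' => h' h⟩
  have hBi : Bi ρ A i = interior (Mi ρ A i \ pastOfBoundary ρ A i) := by
    apply hinj
    rw [hq.preimage_interior_eq_interior_preimage continuous_quotMk,
      preimage_Mi_diff_pastOfBoundary hn hO, preimage_Bi hn hO hA hac hne,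
      ← hv.preimage_interior_eq_interior_preimage continuous_subtype_val,
      interior_unseeingSet hn hA hac hne]
  have hsub : Bi ρ A i ⊆ Mi ρ A i \ pastOfBoundary ρ A i := hBi ▸ interior_subset
  refine ⟨?_, hsub.trans sdiff_subset, fun P hP => ?_, hBi, ?_, ?_, fun hnt => ?_⟩
  · obtain ⟨q, hq⟩ := boundaryDomain_nonempty hn hA hac hne hsphere
    exact ⟨quotMk ρ A ⟨q, hq.1⟩, ⟨q, hq.1⟩, hq.2, rfl⟩
  · exact (hdiff.symm ▸ hsub hP : P ∈ {P | P ∈ Mi ρ A i ∧ ¬ SeesBoundary ρ A P}).2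
  · rw [hdiff]
    apply hinj
    rw [preimage_union, preimage_inter,
      hq.preimage_frontier_eq_frontier_preimage continuous_quotMk,
      preimage_Mi_diff_pastOfBoundary hn hO, preimage_Bi hn hO hA hac hne, preimage_Mi hn hO,
      ← hv.preimage_frontier_eq_frontier_preimage continuous_subtype_val,
      unseeingSet_eq hn hA hac hne, preimage_union, preimage_inter]
  · have hsubset : regularDomain i (upperGraph A) ⊆ invisibleDomain (einIncl '' A) :=
      inter_subset_right.trans
        (invisibleDomain_anti (image_mono (subset_upperGraph hn hA hac)))
    have hv_ind : IsInducing (Subtype.val : invisibleDomain (einIncl '' A) → Ein (n + 1)) :=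
      IsInducing.subtypeVal
    have h := isPreconnected_regularDomain_upperGraph hn hA hac hne i
    rw [← inter_eq_right.2 hsubset, ← Subtype.image_preimage_coe] at h
    exact (hv_ind.isPreconnected_image.1 h).image _ continuous_quotMk.continuousOn
  · obtain ⟨p, hp⟩ := regularDomain_upperGraph_nonempty hn hA hac hnt i
    have hp' := invisibleDomain_anti (image_mono (subset_upperGraph hn hA hac)) hp.2
    exact ⟨quotMk ρ A ⟨p, hp'⟩, ⟨p, hp'⟩, hp, rfl⟩

end AdSBlackHole

end

theorem proposition5 {n : ℕ} (hn : 2 ≤ n) {Γ : Type*} [Group Γ] (S : Finset Γ)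
    (hΓ : AdSBlackHole.IsHyperbolicGroup S) (ρ : Γ →* AdSBlackHole.Mat n)
    (hρ : AdSBlackHole.IsP1Anosov S ρ)
    (Lam : Set (AdSBlackHole.Ein n)) (hacausal : AdSBlackHole.IsAcausal Lam)
    (hlift : AdSBlackHole.einProj '' Lam = AdSBlackHole.limitSet (Set.range ρ))
    (hne : Lam.Nonempty) (hsphere : ¬ Nonempty (Lam ≃ₜ AdSBlackHole.Sph n)) (i : Fin 2) :
    (AdSBlackHole.conformalBoundary ρ Lam).Nonempty ∧
    AdSBlackHole.Bi ρ Lam i ⊆ AdSBlackHole.Mi ρ Lam i ∧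
    (∀ P ∈ AdSBlackHole.Bi ρ Lam i, ¬ AdSBlackHole.SeesBoundary ρ Lam P) ∧
    AdSBlackHole.Bi ρ Lam i =
      interior (AdSBlackHole.Mi ρ Lam i \ AdSBlackHole.pastOfBoundary ρ Lam i) ∧
    {P | P ∈ AdSBlackHole.Mi ρ Lam i ∧ ¬ AdSBlackHole.SeesBoundary ρ Lam P} =
      AdSBlackHole.Bi ρ Lam i ∪
        (frontier (AdSBlackHole.Bi ρ Lam i) ∩ AdSBlackHole.Mi ρ Lam i) ∧
    IsPreconnected (AdSBlackHole.Bi ρ Lam i) ∧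
    (Lam.Nontrivial → (AdSBlackHole.Bi ρ Lam i).Nonempty) :=
  AdSBlackHole.blackHole_of_isCompact hn hρ.mem_O₀
    (AdSBlackHole.isCompact_of_einProj_image_eq_limitSet hn hacausal hne hlift) hacausal hne
    hsphere i
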